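/- Let $d\ge 1$ be an integer, let $\alpha\in(1-1/d,1]$ and let $D\in\mathbb R$. There is a finite constant $C\ge 0$, depending only on $d$, $\alpha$ and $D$, such that for every convex compact set $\Omega\subset\mathbb R^d$ with diameter $D$, all Borel probability measures $\mu_0,\mu_1$ on $\Omega$ and every real $p\ge 1/\alpha$, $$d_\alpha(\mu_0,\mu_1)\le C\,W_p(\mu_0,\mu_1)^{d(\alpha-1)+1}.$$ Here $W_p(\mu_0,\mu_1)=\left(\inf_\gamma\int_{\Omega\times\Omega}|x-y|^p\,d\gamma(x,y)\right)^{1/p}$, the infimum being over the measures $\gamma$ on $\Omega\times\Omega$ with marginals $\mu_0$ and $\mu_1$, is the Wasserstein distance. The branched transport distance is $$d_\alpha(\mu_0,\mu_1)=\inf_Q\int\int_0^1|\sigma(t)|_Q^{\alpha-1}\,|\sigma'(t)|\,dt\,dQ(\sigma),\qquad |x|_Q=Q(\{\sigma : x\in\sigma([0,1])\}),$$ where the infimum is over the traffic plans from $\mu_0$ to $\mu_1$, i.e. the Borel probability measures $Q$ on $C([0,1];\Omega)$ that are concentrated on Lipschitz curves and whose images under $\sigma\mapsto\sigma(0)$ and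 $\sigma\mapsto\sigma(1)$ are $\mu_0$ and $\mu_1$. (For $\alpha<1$ the conventions $0^{\alpha-1}=+\infty$ and $(+\infty)\cdot 0=0$ are used.) -/

import Mathlib

open MeasureTheory Set
open scoped ENNReal NNReal

noncomputable section

namespace BranchedTransport

/-- The Euclidean space `ℝ^d`. -/
abbrev E (d : ℕ) : Type := EuclideanSpace ℝ (Fin d)

/-- The space `C([0,1]; Ω)` of continuous curves in `Ω`, with the topology of uniform
convergence. -/
abbrev Curve {d : ℕ} (Ω : Set (E d)) : Type := C(unitInterval, Ω)

/-- Curves carry the Borel σ-algebra. -/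
instance instMeasurableSpaceCurve {d : ℕ} (Ω : Set (E d)) : MeasurableSpace (Curve Ω) :=
  borel (Curve Ω)

instance instBorelSpaceCurve {d : ℕ} (Ω : Set (E d)) : BorelSpace (Curve Ω) := ⟨rfl⟩

/-- The velocity `σ'(t)`. The curve is extended by constants outside `[0,1]`, which does not
affect the derivative at the points of the open interval `(0,1)`. -/
def velocity {d : ℕ} {Ω : Set (E d)} (σ : Curve Ω) (t : unitInterval) : E d :=
  deriv (fun s : ℝ => (σ (projIcc 0 1 zero_le_one s) : E d)) (t : ℝ)

/-- The multiplicity `|x|_Q = Q {σ | x ∈ σ([0,1])}`. -/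
def curveMultiplicity {d : ℕ} {Ω : Set (E d)} (Q : Measure (Curve Ω)) (x : Ω) : ℝ≥0∞ :=
  Q {σ : Curve Ω | x ∈ range σ}

/-- The energy `E_α(Q) = ∫ ∫₀¹ |σ(t)|_Q^(α-1) |σ'(t)| dt dQ(σ)`. -/
def energy {d : ℕ} {Ω : Set (E d)} (α : ℝ) (Q : Measure (Curve Ω)) : ℝ≥0∞ :=
  ∫⁻ σ : Curve Ω, (∫⁻ t : unitInterval, curveMultiplicity Q (σ t) ^ (α - 1) * ‖velocity σ t‖ₑ) ∂Q

/-- `Q` is a traffic plan from `μ₀` to `μ₁`: a Borel probability measure on curves, concentrated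
on Lipschitz curves, whose time marginals at `t = 0` and `t = 1` are `μ₀` and `μ₁`. -/
structure IsTrafficPlan {d : ℕ} {Ω : Set (E d)} (μ₀ μ₁ : Measure Ω) (Q : Measure (Curve Ω)) :
    Prop where
  isProbabilityMeasure : IsProbabilityMeasure Q
  ae_lipschitz : ∀ᵐ σ : Curve Ω ∂Q, ∃ K : ℝ≥0, LipschitzWith K σ
  map_zero : Q.map (fun σ : Curve Ω => σ 0) = μ₀
  map_one : Q.map (fun σ : Curve Ω => σ 1) = μ₁

/-- The branched transport distance `d_α(μ₀, μ₁)`: the infimum of the energy among traffic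
plans from `μ₀` to `μ₁`. -/
def branchedDist {d : ℕ} {Ω : Set (E d)} (α : ℝ) (μ₀ μ₁ : Measure Ω) : ℝ≥0∞ :=
  ⨅ (Q : Measure (Curve Ω)) (_ : IsTrafficPlan μ₀ μ₁ Q), energy α Q

/-- `γ` is a transport plan between `μ₀` and `μ₁`. -/
structure IsTransportPlan {d : ℕ} {Ω : Set (E d)} (μ₀ μ₁ : Measure Ω) (γ : Measure (Ω × Ω)) :
    Prop where
  map_fst : γ.map Prod.fst = μ₀
  map_snd : γ.map Prod.snd = μ₁

/-- The Wasserstein distance `W_p(μ₀, μ₁)`, where `edist` is the Euclidean distance. -/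
def wasserstein {d : ℕ} {Ω : Set (E d)} (p : ℝ) (μ₀ μ₁ : Measure Ω) : ℝ≥0∞ :=
  (⨅ (γ : Measure (Ω × Ω)) (_ : IsTransportPlan μ₀ μ₁ γ), ∫⁻ z, edist z.1 z.2 ^ p ∂γ) ^ (1 / p)

end BranchedTransport

end

/-! Fix a transport plan `γ` and a length R bounding the diameter, and send mass along dyadic trees.
A pair (x, y) of distinct points with |x - y| about R/2^i follows a polygonal curve: from x through
points of Ω chosen in its dyadic cells of side R/2^(i+n), with n decreasing to 0, across to the
chosen point of the cell of y at level i, then down through the cells of y. Diagonal pairs stay put.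
Each step has a time interval that does not depend on the pair, so pairs with the same scale and the
same cells at step n move together. The multiplicity is then at least the mass of their class
(`le_curveMultiplicity`), and the energy is at most the sum of γ(B)^α times length over all classes
B (`ChainFamily.branchedDist_le`).

At scale i, step n has at most 15^d 2^((i+n)d) classes, each of length O(R/2^(i+n)). With S_i the
set of pairs at scale i, concavity of the power α (`sum_rpow_le_card_mul_rpow_sum`) bounds the
contribution by a constant times 2^(-β(i+n)) γ(S_i)^α, where β = d(α-1)+1. The condition on α says
that β > 0, so the sum over n converges.

It remains to bound the sum over i of 2^(-βi) γ(S_i)^α. By Chebyshev, γ(S_i)^α ≤ min(1, 2^i u),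
where u is the L^(1/α) norm of |x - y| in units of R/2. If β < 1, splitting where 2^i u is about 1
gives O(u^β) (`tsum_geometric_mul_le`). If α = 1, disjointness of the S_i gives the bound directly.
Monotonicity of L^p norms then replaces 1/α by any larger p. -/

namespace BranchedTransport

open Filter Topology

/-! ### Polygonal curves through infinitely many points -/

/-- The piecewise linear function of `r` that increases from `0` to `1` while `r` decreases from
`(2/3)^n` to `(2/3)^(n+1)`. -/
noncomputable def ramp (n : ℕ) (r : ℝ) : ℝ := max 0 (min 1 (3 - 3 * r * (3 / 2) ^ n))

lemma ramp_nonneg (n : ℕ) (r : ℝ) : 0 ≤ ramp n r := le_max_left _ _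

lemma ramp_le_one (n : ℕ) (r : ℝ) : ramp n r ≤ 1 := max_le zero_le_one (min_le_left _ _)

lemma ramp_eq_zero {n : ℕ} {r : ℝ} (h : 1 ≤ r * (3 / 2) ^ n) : ramp n r = 0 :=
  max_eq_left ((min_le_right _ _).trans (by nlinarith))

lemma ramp_eq_one {n : ℕ} {r : ℝ} (h : r * (3 / 2) ^ (n + 1) ≤ 1) : ramp n r = 1 := by
  rw [pow_succ] at h
  rw [ramp, min_eq_left (by nlinarith), max_eq_right zero_le_one]

lemma ramp_eq_self {n : ℕ} {r : ℝ} (h₁ : r * (3 / 2) ^ n ≤ 1) (h₂ : 1 ≤ r * (3 / 2) ^ (n + 1)) :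
    ramp n r = 3 - 3 * r * (3 / 2) ^ n := by
  rw [pow_succ] at h₂
  rw [ramp, min_eq_right (by nlinarith), max_eq_right (by nlinarith)]

lemma abs_ramp_sub_le (n : ℕ) (r s : ℝ) : |ramp n r - ramp n s| ≤ 3 * (3 / 2) ^ n * |r - s| := by
  have h : |ramp n r - ramp n s| ≤ |(3 - 3 * r * (3 / 2) ^ n) - (3 - 3 * s * (3 / 2) ^ n)| := by
    refine (abs_max_sub_max_le_max _ _ _ _).trans ?_
    rw [sub_self, abs_zero, max_eq_right (abs_nonneg _)]
    refine (abs_min_sub_min_le_max _ _ _ _).trans ?_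
    rw [sub_self, abs_zero, max_eq_right (abs_nonneg _)]
  refine h.trans (le_of_eq ?_)
  rw [show (3 - 3 * r * (3 / 2 : ℝ) ^ n) - (3 - 3 * s * (3 / 2) ^ n)
    = (3 * (3 / 2) ^ n) * (s - r) by ring, abs_mul, abs_of_nonneg (by positivity), abs_sub_comm]

variable {V : Type*} [NormedAddCommGroup V] [NormedSpace ℝ V]

/-- The polygonal curve through the points `q 0, q 1, …`, at the point `q n` at time `(2/3)^n`. -/
noncomputable def ray (q : ℕ → V) (r : ℝ) : V := q 0 + ∑' n, ramp n r • (q (n + 1) - q n)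

lemma ray_of_one_le (q : ℕ → V) {r : ℝ} (hr : 1 ≤ r) : ray q r = q 0 := by
  have h (n : ℕ) : ramp n r = 0 := ramp_eq_zero (by
    have : (1 : ℝ) ≤ (3 / 2) ^ n := one_le_pow₀ (by norm_num)
    nlinarith)
  simp [ray, h]

/-- The ramps of index below n are complete and telescope to q n - q 0; those of index above n have
not started. -/
lemma ray_eq (q : ℕ → V) {n : ℕ} {r : ℝ} (h₁ : r * (3 / 2) ^ n ≤ 1)
    (h₂ : 1 ≤ r * (3 / 2) ^ (n + 1)) :
    ray q r = q n + (3 - 3 * r * (3 / 2) ^ n) • (q (n + 1) - q n) := by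
  have hr : 0 ≤ r := by
    by_contra! h
    have : r * (3 / 2) ^ (n + 1) ≤ 0 := mul_nonpos_of_nonpos_of_nonneg h.le (by positivity)
    linarith
  have hz : ∀ m ∉ Finset.range (n + 1), ramp m r • (q (m + 1) - q m) = 0 := by
    intro m hm
    rw [Finset.mem_range, not_lt] at hm
    rw [ramp_eq_zero, zero_smul]
    refine h₂.trans (mul_le_mul_of_nonneg_left (pow_le_pow_right₀ (by norm_num) hm) hr)
  rw [ray, tsum_eq_sum hz, Finset.sum_range_succ, ramp_eq_self h₁ h₂]
  have : ∑ m ∈ Finset.range n, ramp m r • (q (m + 1) - q m) = q n - q 0 := by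
    rw [← Finset.sum_range_sub q n]
    refine Finset.sum_congr rfl fun m hm => ?_
    rw [Finset.mem_range] at hm
    rw [ramp_eq_one, one_smul]
    exact (mul_le_mul_of_nonneg_left (pow_le_pow_right₀ (by norm_num) hm) hr).trans h₁
  rw [this]
  abel

lemma exists_pow_bounds {r : ℝ} (h₀ : 0 < r) (h₁ : r ≤ 1) :
    ∃ n : ℕ, r * (3 / 2) ^ n ≤ 1 ∧ 1 < r * (3 / 2) ^ (n + 1) := by
  obtain ⟨n, hn, hn'⟩ := exists_nat_pow_near ((one_le_inv₀ h₀).2 h₁)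
    (show (1 : ℝ) < 3 / 2 by norm_num)
  refine ⟨n, ?_, ?_⟩
  · calc r * (3 / 2) ^ n ≤ r * r⁻¹ := by gcongr
      _ = 1 := mul_inv_cancel₀ h₀.ne'
  · calc 1 = r * r⁻¹ := (mul_inv_cancel₀ h₀.ne').symm
      _ < _ := by gcongr

lemma ray_mem {S : Set V} (hS : Convex ℝ S) {q : ℕ → V} (hq : ∀ n, q n ∈ S) {r : ℝ}
    (hr : 0 < r) : ray q r ∈ S := by
  rcases le_total 1 r with h | h
  · rw [ray_of_one_le q h]; exact hq 0
  · obtain ⟨n, h₁, h₂⟩ := exists_pow_bounds hr h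
    rw [ray_eq q h₁ h₂.le]
    rw [pow_succ] at h₂
    exact hS.add_smul_sub_mem (hq n) (hq (n + 1)) ⟨by nlinarith, by nlinarith⟩

/-- The sequence `q` converges to `x`, with steps decaying like `2⁻ⁿ`. -/
structure IsChain (q : ℕ → V) (x : V) : Prop where
  bound : ∃ B : ℝ, ∀ n, ‖q (n + 1) - q n‖ ≤ B * (1 / 2) ^ n
  tendsto : Tendsto q atTop (𝓝 x)

namespace IsChain

variable {q : ℕ → V} {x : V}

lemma summable_norm (h : IsChain q x) (r : ℝ) :
    Summable fun n => ‖ramp n r • (q (n + 1) - q n)‖ := by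
  obtain ⟨B, hB⟩ := h.bound
  refine Summable.of_nonneg_of_le (fun _ => norm_nonneg _) (fun n => ?_)
    (summable_geometric_two.mul_left B)
  rw [norm_smul, Real.norm_of_nonneg (ramp_nonneg n r)]
  exact (mul_le_of_le_one_left (norm_nonneg _) (ramp_le_one n r)).trans (hB n)

variable [CompleteSpace V]

lemma ray_zero (h : IsChain q x) : ray q 0 = x := by
  have h1 (n : ℕ) : ramp n 0 = 1 := ramp_eq_one (by simp)
  have hs := (h.summable_norm 0).of_norm
  simp only [ray, h1, one_smul] at hs ⊢
  have ht := hs.hasSum.tendsto_sum_nat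
  simp only [Finset.sum_range_sub] at ht
  rw [tendsto_nhds_unique ht (h.tendsto.sub_const (q 0))]
  abel

/-- The n-th ramp has slope at most 3(3/2)^n and the n-th step is O(2^(-n)), so the Lipschitz
constants sum as a geometric series of ratio 3/4. Breakpoints shrinking by 2/3, more slowly than the
steps, make this ratio less than 1. -/
lemma exists_lipschitzWith_ray (h : IsChain q x) : ∃ K : ℝ≥0, LipschitzWith K (ray q) := by
  obtain ⟨B, hB⟩ := h.bound
  have hB0 : 0 ≤ B := by simpa using (norm_nonneg _).trans (hB 0)
  have hg : HasSum (fun n : ℕ => 3 * B * (3 / 4 : ℝ) ^ n) (3 * B * 4) := by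
    have := (hasSum_geometric_of_lt_one (r := (3 / 4 : ℝ)) (by norm_num) (by norm_num)).mul_left
      (3 * B)
    rwa [show (1 - 3 / 4 : ℝ)⁻¹ = 4 by norm_num] at this
  refine ⟨⟨3 * B * 4, by positivity⟩, LipschitzWith.of_dist_le_mul fun r s => ?_⟩
  rw [dist_eq_norm, ray, ray, add_sub_add_left_eq_sub,
    ← (h.summable_norm r).of_norm.tsum_sub (h.summable_norm s).of_norm]
  refine tsum_of_norm_bounded (hg.mul_right (dist r s)) fun n => ?_
  rw [← sub_smul, norm_smul, Real.norm_eq_abs, Real.dist_eq]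
  calc |ramp n r - ramp n s| * ‖q (n + 1) - q n‖
      ≤ (3 * (3 / 2) ^ n * |r - s|) * (B * (1 / 2) ^ n) := by
        gcongr
        · exact abs_ramp_sub_le n r s
        · exact hB n
    _ = 3 * B * (3 / 4) ^ n * |r - s| := by
        rw [show (3 / 4 : ℝ) = 3 / 2 * (1 / 2) by norm_num, mul_pow]; ring

lemma ray_mem_of_nonneg (h : IsChain q x) {S : Set V} (hS : Convex ℝ S) (hq : ∀ n, q n ∈ S)
    (hx : x ∈ S) {r : ℝ} (hr : 0 ≤ r) : ray q r ∈ S := by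
  rcases hr.eq_or_lt with rfl | hr
  · rwa [h.ray_zero]
  · exact ray_mem hS hq hr

end IsChain

/-- The curve on `[0,1]` that runs backwards through `p`, from its limit to `p 0` at time `1/2`,
and then through `q` to its limit. -/
noncomputable def pathFun (p q : ℕ → V) (t : ℝ) : V := ray p (2 * t) + ray q (2 - 2 * t) - q 0

lemma pathFun_of_le (p q : ℕ → V) {t : ℝ} (ht : t ≤ 1 / 2) : pathFun p q t = ray p (2 * t) := by
  rw [pathFun, ray_of_one_le q (by linarith), add_sub_cancel_right]

lemma pathFun_of_ge {p q : ℕ → V} (h : p 0 = q 0) {t : ℝ} (ht : 1 / 2 ≤ t) :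
    pathFun p q t = ray q (2 - 2 * t) := by
  rw [pathFun, ray_of_one_le p (by linarith), h, add_sub_cancel_left]

end BranchedTransport

/-! ### Curves in Ω: measurability, endpoints, velocity -/

namespace BranchedTransport

open Filter Topology

/-- Evaluation at a dense sequence of times is a continuous injection of a Polish space, hence a
measurable embedding by Lusin–Souslin. -/
lemma measurable_curve_of_eval {d : ℕ} {Ω : Set (E d)} (hΩ : IsCompact Ω) {Z : Type*}
    [MeasurableSpace Z] {Φ : Z → Curve Ω} (h : ∀ t, Measurable fun z => Φ z t) :
    Measurable Φ := by
  have : CompactSpace Ω := isCompact_iff_compactSpace.1 hΩ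
  let ev : Curve Ω → ℕ → Ω := fun σ k => σ (TopologicalSpace.denseSeq unitInterval k)
  have hc : Continuous ev := by fun_prop
  have hi : Function.Injective ev := fun σ τ hστ => by
    refine DFunLike.coe_injective (Continuous.ext_on
      (TopologicalSpace.denseRange_denseSeq unitInterval) σ.continuous τ.continuous ?_)
    rintro _ ⟨k, rfl⟩
    exact congrFun hστ k
  exact (hc.measurableEmbedding hi).measurable_comp_iff.1 (measurable_pi_lambda _ fun k => h _)

variable {d : ℕ} {Ω : Set (E d)}

/-- `pathFun` as a curve in a convex set. -/
noncomputable def chainCurve (hΩ : Convex ℝ Ω) {p q : ℕ → Ω} {x y : Ω}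
    (hp : IsChain (fun n => (p n : E d)) x) (hq : IsChain (fun n => (q n : E d)) y)
    (h0 : p 0 = q 0) : Curve Ω where
  toFun t := ⟨pathFun (fun n => (p n : E d)) (fun n => (q n : E d)) t, by
    rcases le_total (t : ℝ) (1 / 2) with ht | ht
    · rw [pathFun_of_le _ _ ht]
      exact hp.ray_mem_of_nonneg hΩ (fun n => (p n).2) x.2 (by linarith [t.2.1])
    · rw [pathFun_of_ge (congrArg Subtype.val h0) ht]
      exact hq.ray_mem_of_nonneg hΩ (fun n => (q n).2) y.2 (by linarith [t.2.2])⟩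
  continuous_toFun := by
    refine Continuous.subtype_mk ?_ _
    obtain ⟨K, hK⟩ := hp.exists_lipschitzWith_ray
    obtain ⟨K', hK'⟩ := hq.exists_lipschitzWith_ray
    have := hK.continuous
    have := hK'.continuous
    unfold pathFun
    fun_prop

section chainCurve

variable (hΩ : Convex ℝ Ω) {p q : ℕ → Ω} {x y : Ω}
    (hp : IsChain (fun n => (p n : E d)) x) (hq : IsChain (fun n => (q n : E d)) y)
    (h0 : p 0 = q 0)

lemma chainCurve_zero : chainCurve hΩ hp hq h0 0 = x := by
  apply Subtype.ext
  change pathFun _ _ ((0 : unitInterval) : ℝ) = _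
  rw [pathFun_of_le _ _ (by simp)]
  simp [hp.ray_zero]

lemma chainCurve_one : chainCurve hΩ hp hq h0 1 = y := by
  apply Subtype.ext
  change pathFun _ _ ((1 : unitInterval) : ℝ) = _
  rw [pathFun_of_ge (congrArg Subtype.val h0) (by norm_num)]
  simp [hq.ray_zero]

lemma exists_lipschitzWith_chainCurve : ∃ K : ℝ≥0, LipschitzWith K (chainCurve hΩ hp hq h0) := by
  obtain ⟨K, hK⟩ := hp.exists_lipschitzWith_ray
  obtain ⟨K', hK'⟩ := hq.exists_lipschitzWith_ray
  refine ⟨2 * K + 2 * K', LipschitzWith.of_dist_le_mul fun s t => ?_⟩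
  rw [Subtype.dist_eq, Subtype.dist_eq]
  change dist (pathFun _ _ _) (pathFun _ _ _) ≤ _
  rw [pathFun, pathFun, dist_sub_right]
  refine (dist_add_add_le _ _ _ _).trans ?_
  have h1 := hK.dist_le_mul (2 * (s : ℝ)) (2 * t)
  have h2 := hK'.dist_le_mul (2 - 2 * (s : ℝ)) (2 - 2 * t)
  have e1 : dist (2 * (s : ℝ)) (2 * t) = 2 * dist (s : ℝ) t := by
    rw [Real.dist_eq, Real.dist_eq, ← mul_sub, abs_mul, abs_two]
  rw [dist_sub_left, e1] at h2
  rw [e1] at h1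
  push_cast
  linarith

end chainCurve

lemma velocity_eq_of_affine {σ : Curve Ω} {a b : ℝ} {u v : E d} (ha : 0 ≤ a) (hb : b ≤ 1)
    (h : ∀ s : unitInterval, (s : ℝ) ∈ Ioo a b → (σ s : E d) = u + (s : ℝ) • v)
    {t : unitInterval} (ht : (t : ℝ) ∈ Ioo a b) : velocity σ t = v := by
  have hev : (fun s : ℝ => (σ (projIcc 0 1 zero_le_one s) : E d)) =ᶠ[𝓝 (t : ℝ)]
      fun s => u + s • v := by
    filter_upwards [Ioo_mem_nhds ht.1 ht.2] with s hs
    have hs' : s ∈ Icc (0 : ℝ) 1 := ⟨ha.trans hs.1.le, hs.2.le.trans hb⟩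
    rw [projIcc_of_mem _ hs']
    exact h ⟨s, hs'⟩ hs
  rw [velocity, hev.deriv_eq]
  have : HasDerivAt (fun s : ℝ => u + s • v) ((1 : ℝ) • v) (t : ℝ) :=
    ((hasDerivAt_id (t : ℝ)).smul_const v).const_add u
  rw [this.deriv, one_smul]

end BranchedTransport

/-! ### Energy of one curve, piece by piece -/

namespace BranchedTransport

open Filter Topology

variable {d : ℕ} {Ω : Set (E d)}

/-- The points of the open interval `(a,b)` in the unit interval. -/
def piece (a b : ℝ) : Set unitInterval := Subtype.val ⁻¹' Ioo a b

lemma measurableSet_piece (a b : ℝ) : MeasurableSet (piece a b) :=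
  measurable_subtype_coe measurableSet_Ioo

lemma volume_piece_le (a b : ℝ) : volume (piece a b) ≤ ENNReal.ofReal (b - a) := by
  rw [unitInterval.volume_def, piece,
    (MeasurableEmbedding.subtype_coe measurableSet_Icc).comap_apply, ← Real.volume_Ioo]
  exact measure_mono (image_preimage_subset _ _)

/-- Since α - 1 ≤ 0, a lower bound on the multiplicity bounds the weight from above, and the
velocity is constant on the piece. -/
lemma setLIntegral_piece_le {α : ℝ} (hα : α ≤ 1) (Q : Measure (Curve Ω)) {σ : Curve Ω}
    {a b : ℝ} {u v : E d} (ha : 0 ≤ a) (hb : b ≤ 1)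
    (h : ∀ s ∈ piece a b, (σ s : E d) = u + (s : ℝ) • v) {c : ℝ≥0∞}
    (hc : ∀ s ∈ piece a b, c ≤ curveMultiplicity Q (σ s)) :
    ∫⁻ t in piece a b, curveMultiplicity Q (σ t) ^ (α - 1) * ‖velocity σ t‖ₑ ≤
      c ^ (α - 1) * (‖v‖ₑ * ENNReal.ofReal (b - a)) := by
  calc _ ≤ ∫⁻ t in piece a b, c ^ (α - 1) * ‖v‖ₑ := by
        refine setLIntegral_mono' (measurableSet_piece a b) fun t ht => ?_
        rw [velocity_eq_of_affine ha hb h ht]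
        refine mul_le_mul' ?_ le_rfl
        rw [← neg_sub, ENNReal.rpow_neg, ENNReal.rpow_neg]
        exact ENNReal.inv_le_inv.2 (ENNReal.rpow_le_rpow (hc t ht) (by linarith))
    _ ≤ _ := by
        rw [setLIntegral_const, mul_assoc]
        gcongr
        exact volume_piece_le a b

/-- The times at which `pathFun p q` runs from `p (n+1)` to `p n`. -/
abbrev leftPiece (n : ℕ) : Set unitInterval :=
  piece ((2 / 3) ^ (n + 1) / 2) ((2 / 3) ^ n / 2)

/-- The times at which `pathFun p q` runs from `q n` to `q (n+1)`. -/
abbrev rightPiece (n : ℕ) : Set unitInterval :=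
  piece (1 - (2 / 3) ^ n / 2) (1 - (2 / 3) ^ (n + 1) / 2)

lemma two_thirds_pow_mul (n : ℕ) : (2 / 3 : ℝ) ^ n * (3 / 2) ^ n = 1 := by
  rw [← mul_pow]; norm_num

lemma two_thirds_pow_le_one (n : ℕ) : (2 / 3 : ℝ) ^ n ≤ 1 :=
  pow_le_one₀ (by norm_num) (by norm_num)

lemma ray_eq_of_mem_Icc {V : Type*} [NormedAddCommGroup V] [NormedSpace ℝ V] (q : ℕ → V) {n : ℕ}
    {r : ℝ} (hr : r ∈ Icc ((2 / 3 : ℝ) ^ (n + 1)) ((2 / 3) ^ n)) :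
    ray q r = q n + (3 - 3 * r * (3 / 2) ^ n) • (q (n + 1) - q n) := by
  refine ray_eq q ?_ ?_
  · rw [← two_thirds_pow_mul n]
    exact mul_le_mul_of_nonneg_right hr.2 (by positivity)
  · rw [← two_thirds_pow_mul (n + 1)]
    exact mul_le_mul_of_nonneg_right hr.1 (by positivity)

lemma exists_mem_Ioo_of_notMem {r : ℝ} (h₀ : 0 < r) (h₁ : r ≤ 1)
    (hr : r ∉ range fun n : ℕ => (2 / 3 : ℝ) ^ n) :
    ∃ n : ℕ, r ∈ Ioo ((2 / 3 : ℝ) ^ (n + 1)) ((2 / 3) ^ n) := by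
  obtain ⟨n, hn, hn'⟩ := exists_nat_pow_near_of_lt_one h₀ h₁
    (show (0 : ℝ) < 2 / 3 by norm_num) (by norm_num)
  exact ⟨n, hn, lt_of_le_of_ne hn' fun h => hr ⟨n, h.symm⟩⟩

lemma ae_mem_pieces :
    ∀ᵐ t : unitInterval, t ∈ (⋃ n, leftPiece n) ∪ ⋃ n, rightPiece n := by
  let S : Set ℝ := {0} ∪ range fun n : ℕ => (2 / 3 : ℝ) ^ n
  have hS : S.Countable := (countable_singleton 0).union (countable_range _)
  have h1 : {t : unitInterval | 2 * (t : ℝ) ∈ S}.Countable :=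
    hS.preimage (f := fun t : unitInterval => 2 * (t : ℝ)) fun s t h =>
      Subtype.ext (by simpa using h)
  have h2 : {t : unitInterval | 2 - 2 * (t : ℝ) ∈ S}.Countable :=
    hS.preimage (f := fun t : unitInterval => 2 - 2 * (t : ℝ)) fun s t h =>
      Subtype.ext (by simpa using h)
  filter_upwards [h1.ae_notMem volume, h2.ae_notMem volume] with t ht1 ht2
  simp only [S, mem_union, mem_singleton_iff, not_or] at ht1 ht2
  rcases le_total (t : ℝ) (1 / 2) with ht | ht
  · left
    obtain ⟨n, hn⟩ := exists_mem_Ioo_of_notMem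
      (lt_of_le_of_ne (by linarith [t.2.1]) (Ne.symm ht1.1)) (by linarith) ht1.2
    exact mem_iUnion.2 ⟨n, by linarith [hn.1], by linarith [hn.2]⟩
  · right
    obtain ⟨n, hn⟩ := exists_mem_Ioo_of_notMem
      (lt_of_le_of_ne (by linarith [t.2.2]) (Ne.symm ht2.1)) (by linarith) ht2.2
    exact mem_iUnion.2 ⟨n, by linarith [hn.2], by linarith [hn.1]⟩

/-- Subadditivity suffices, so the energy density need not be shown measurable. -/
lemma lintegral_le_pieces (f : unitInterval → ℝ≥0∞) :
    ∫⁻ t, f t ≤ ∑' n, ((∫⁻ t in leftPiece n, f t) + ∫⁻ t in rightPiece n, f t) := by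
  rw [ENNReal.tsum_add]
  calc ∫⁻ t, f t = ∫⁻ t in (⋃ n, leftPiece n) ∪ ⋃ n, rightPiece n, f t := by
        rw [Measure.restrict_eq_self_of_ae_mem ae_mem_pieces]
    _ ≤ _ := lintegral_union_le _ _ _
    _ ≤ _ := add_le_add (lintegral_iUnion_le _ _) (lintegral_iUnion_le _ _)

section chainCurve

variable (hΩ : Convex ℝ Ω) {p q : ℕ → Ω} {x y : Ω}
    (hp : IsChain (fun n => (p n : E d)) x) (hq : IsChain (fun n => (q n : E d)) y)
    (h0 : p 0 = q 0)

lemma chainCurve_of_mem_leftPiece {n : ℕ} {t : unitInterval} (ht : t ∈ leftPiece n) :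
    (chainCurve hΩ hp hq h0 t : E d) = ((p n : E d) + (3 : ℝ) • ((p (n + 1) : E d) - p n)) +
      (t : ℝ) • (-(6 * (3 / 2) ^ n) : ℝ) • ((p (n + 1) : E d) - p n) := by
  change pathFun _ _ _ = _
  have := two_thirds_pow_le_one n
  have h1 := ht.1
  have h2 := ht.2
  rw [pathFun_of_le _ _ (by linarith), ray_eq_of_mem_Icc _ ⟨by linarith, by linarith⟩]
  module

lemma chainCurve_of_mem_rightPiece {n : ℕ} {t : unitInterval} (ht : t ∈ rightPiece n) :
    (chainCurve hΩ hp hq h0 t : E d) =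
      ((q n : E d) + (3 - 6 * (3 / 2) ^ n : ℝ) • ((q (n + 1) : E d) - q n)) +
      (t : ℝ) • (6 * (3 / 2) ^ n : ℝ) • ((q (n + 1) : E d) - q n) := by
  change pathFun _ _ _ = _
  have := two_thirds_pow_le_one n
  have h1 := ht.1
  have h2 := ht.2
  rw [pathFun_of_ge (congrArg Subtype.val h0) (by linarith),
    ray_eq_of_mem_Icc _ ⟨by linarith, by linarith⟩]
  module

lemma enorm_smul_mul_ofReal (n : ℕ) {c : ℝ} (hc : |c| = 6 * (3 / 2) ^ n) (u v : Ω) {l : ℝ}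
    (hl : l = (2 / 3) ^ n / 6) :
    ‖c • ((v : E d) - u)‖ₑ * ENNReal.ofReal l = edist u v := by
  rw [enorm_smul, Real.enorm_eq_ofReal_abs, hc, mul_right_comm,
    ← ENNReal.ofReal_mul (by positivity), Subtype.edist_eq, edist_comm, edist_eq_enorm_sub]
  have : 6 * (3 / 2 : ℝ) ^ n * l = 1 := by
    rw [hl, ← two_thirds_pow_mul n]; ring
  rw [this, ENNReal.ofReal_one, one_mul]

lemma setLIntegral_leftPiece_le {α : ℝ} (hα : α ≤ 1) (Q : Measure (Curve Ω)) (n : ℕ) {c : ℝ≥0∞}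
    (hc : ∀ s ∈ leftPiece n, c ≤ curveMultiplicity Q (chainCurve hΩ hp hq h0 s)) :
    ∫⁻ t in leftPiece n, curveMultiplicity Q (chainCurve hΩ hp hq h0 t) ^ (α - 1) *
      ‖velocity (chainCurve hΩ hp hq h0) t‖ₑ ≤ c ^ (α - 1) * edist (p n) (p (n + 1)) := by
  refine (setLIntegral_piece_le hα Q (by positivity) (by linarith [two_thirds_pow_le_one n])
    (fun s hs => chainCurve_of_mem_leftPiece hΩ hp hq h0 hs) hc).trans_eq ?_
  rw [enorm_smul_mul_ofReal n (by rw [abs_neg, abs_of_pos (by positivity)]) (p n) (p (n + 1))]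
  rw [pow_succ]; ring

lemma setLIntegral_rightPiece_le {α : ℝ} (hα : α ≤ 1) (Q : Measure (Curve Ω)) (n : ℕ) {c : ℝ≥0∞}
    (hc : ∀ s ∈ rightPiece n, c ≤ curveMultiplicity Q (chainCurve hΩ hp hq h0 s)) :
    ∫⁻ t in rightPiece n, curveMultiplicity Q (chainCurve hΩ hp hq h0 t) ^ (α - 1) *
      ‖velocity (chainCurve hΩ hp hq h0) t‖ₑ ≤ c ^ (α - 1) * edist (q n) (q (n + 1)) := by
  have h1 : (0 : ℝ) < (2 / 3) ^ (n + 1) := by positivity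
  refine (setLIntegral_piece_le hα Q (by linarith [two_thirds_pow_le_one n])
    (by linarith) (fun s hs => chainCurve_of_mem_rightPiece hΩ hp hq h0 hs) hc).trans_eq ?_
  rw [enorm_smul_mul_ofReal n (abs_of_pos (by positivity)) (q n) (q (n + 1))]
  rw [pow_succ]; ring

end chainCurve

end BranchedTransport

/-! ### Traffic plans from measurable families of chains -/

namespace BranchedTransport

open Filter Topology

variable {d : ℕ} {Ω : Set (E d)} {Z : Type*} [MeasurableSpace Z]

/-- A measurable family of two-sided chains of points of `Ω`, joining `x z` to `y z`. -/
structure ChainFamily (x y : Z → Ω) where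
  left : Z → ℕ → Ω
  right : Z → ℕ → Ω
  measurable_left : ∀ n, Measurable fun z => left z n
  measurable_right : ∀ n, Measurable fun z => right z n
  isChain_left : ∀ z, IsChain (fun n => (left z n : E d)) (x z)
  isChain_right : ∀ z, IsChain (fun n => (right z n : E d)) (y z)
  left_zero : ∀ z, left z 0 = right z 0

/-- The `n`-th step of the chains `p z` is the same for all `z` in `B l`, of length at most `b`,
and it is trivial outside of the union of the `B l`. -/
structure StepCover {L : Type*} (p : Z → ℕ → Ω) (n : ℕ) (B : L → Set Z) (b : L → ℝ≥0∞) :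
    Prop where
  measurableSet : ∀ l, MeasurableSet (B l)
  eq_of_mem : ∀ l, ∀ z ∈ B l, ∀ z' ∈ B l, p z n = p z' n ∧ p z (n + 1) = p z' (n + 1)
  edist_le : ∀ l, ∀ z ∈ B l, edist (p z n) (p z (n + 1)) ≤ b l
  eq_of_notMem : ∀ z, z ∉ ⋃ l, B l → p z n = p z (n + 1)

lemma measurable_ray {p : Z → ℕ → Ω} (hp : ∀ n, Measurable fun z => p z n)
    {x : Z → Ω} (hx : Measurable x) (hpx : ∀ z, IsChain (fun n => (p z n : E d)) (x z)) {r : ℝ}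
    (hr : 0 ≤ r) : Measurable fun z => ray (fun n => (p z n : E d)) r := by
  have hp' (n : ℕ) : Measurable fun z => (p z n : E d) := measurable_subtype_coe.comp (hp n)
  rcases hr.eq_or_lt with rfl | h0
  · simp only [(hpx _).ray_zero]
    exact measurable_subtype_coe.comp hx
  rcases le_total 1 r with h | h
  · simp only [ray_of_one_le _ h]
    exact hp' 0
  · obtain ⟨n, h₁, h₂⟩ := exists_pow_bounds h0 h
    simp only [ray_eq _ h₁ h₂.le]
    fun_prop

/-- The integrand of the energy bound given by a step cover. -/
noncomputable def stepBound {L : Type*} (α : ℝ) (γ : Measure Z)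
    (B : L → Set Z) (b : L → ℝ≥0∞) (z : Z) : ℝ≥0∞ :=
  ∑' l, (B l).indicator (fun _ => γ (B l) ^ (α - 1) * b l) z

lemma measurable_stepBound {L : Type*} [Countable L] (α : ℝ)
    (γ : Measure Z) {B : L → Set Z} (hB : ∀ l, MeasurableSet (B l)) (b : L → ℝ≥0∞) :
    Measurable (stepBound α γ B b) :=
  Measurable.tsum fun l => measurable_const.indicator (hB l)

/-- Integrating over B l supplies the missing factor: γ(B)^(α-1) γ(B) = γ(B)^α. Null classes cost
nothing because ⊤ * 0 = 0. -/
lemma lintegral_stepBound_le {L : Type*} [Countable L] (α : ℝ)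
    (γ : Measure Z) [IsFiniteMeasure γ] {B : L → Set Z}
    (hB : ∀ l, MeasurableSet (B l)) (b : L → ℝ≥0∞) :
    ∫⁻ z, stepBound α γ B b z ∂γ ≤ ∑' l, γ (B l) ^ α * b l := by
  unfold stepBound
  rw [lintegral_tsum fun l => (measurable_const.indicator (hB l)).aemeasurable]
  refine ENNReal.tsum_le_tsum fun l => ?_
  rw [lintegral_indicator_const (hB l), mul_right_comm]
  refine mul_le_mul' ?_ le_rfl
  rcases eq_or_ne (γ (B l)) 0 with h | h
  · simp [h]
  · refine le_of_eq ?_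
    conv_rhs => rw [show α = (α - 1) + 1 by ring,
      ENNReal.rpow_add _ _ h (measure_ne_top _ _), ENNReal.rpow_one]

lemma StepCover.le_stepBound {L : Type*} {p : Z → ℕ → Ω} {n : ℕ}
    {B : L → Set Z} {b : L → ℝ≥0∞} (hB : StepCover p n B b) (α : ℝ) (γ : Measure Z) (z : Z)
    {I : ℝ≥0∞} (h : ∀ c, (c = 0 ∨ ∃ l, z ∈ B l ∧ c = γ (B l)) →
      I ≤ c ^ (α - 1) * edist (p z n) (p z (n + 1))) :
    I ≤ stepBound α γ B b z := by
  by_cases hz : z ∈ ⋃ l, B l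
  · obtain ⟨l, hl⟩ := mem_iUnion.1 hz
    calc I ≤ γ (B l) ^ (α - 1) * edist (p z n) (p z (n + 1)) := h _ (.inr ⟨l, hl, rfl⟩)
      _ ≤ γ (B l) ^ (α - 1) * b l := by gcongr; exact hB.edist_le l z hl
      _ = (B l).indicator (fun _ => γ (B l) ^ (α - 1) * b l) z := by rw [indicator_of_mem hl]
      _ ≤ _ := ENNReal.le_tsum l
  -- Outside all classes only the multiplicity bound 0 is available. Its weight may be ⊤, but the
  -- step has length 0.
  · have := h 0 (.inl rfl)
    rw [hB.eq_of_notMem z hz, edist_self, mul_zero] at this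
    exact this.trans zero_le

namespace ChainFamily

variable {x y : Z → Ω} (F : ChainFamily x y) (hΩ : Convex ℝ Ω)

/-- The curve through the points of the chain of index `z`. -/
noncomputable def curve (z : Z) : Curve Ω :=
  chainCurve hΩ (F.isChain_left z) (F.isChain_right z) (F.left_zero z)

lemma measurable_curve (hc : IsCompact Ω) (hx : Measurable x) (hy : Measurable y) :
    Measurable (F.curve hΩ) := by
  refine measurable_curve_of_eval hc fun t => Measurable.subtype_mk ?_
  exact ((measurable_ray F.measurable_left hx F.isChain_left (by linarith [t.2.1])).add
    (measurable_ray F.measurable_right hy F.isChain_right (by linarith [t.2.2]))).sub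
    (measurable_subtype_coe.comp (F.measurable_right 0))

lemma isTrafficPlan (hc : IsCompact Ω) (hx : Measurable x) (hy : Measurable y) (γ : Measure Z)
    [IsProbabilityMeasure γ] :
    IsTrafficPlan (γ.map x) (γ.map y) (γ.map (F.curve hΩ)) := by
  have hm := F.measurable_curve hΩ hc hx hy
  have hL : MeasurableSet {σ : Curve Ω | ∃ K : ℝ≥0, LipschitzWith K σ} := by
    have : {σ : Curve Ω | ∃ K : ℝ≥0, LipschitzWith K σ} =
        ⋃ k : ℕ, {σ : Curve Ω | LipschitzWith (k : ℝ≥0) σ} := by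
      ext σ
      simp only [mem_ofPred_eq, mem_iUnion]
      refine ⟨fun ⟨K, hK⟩ => ?_, fun ⟨k, hk⟩ => ⟨k, hk⟩⟩
      obtain ⟨k, hk⟩ := exists_nat_ge K
      exact ⟨k, hK.weaken hk⟩
    rw [this]
    refine MeasurableSet.iUnion fun k => IsClosed.measurableSet ?_
    simp only [lipschitzWith_iff_dist_le_mul, ofPred_forall]
    refine isClosed_iInter fun s => isClosed_iInter fun t => isClosed_le ?_ continuous_const
    exact (ContinuousEvalConst.continuous_eval_const s).dist
      (ContinuousEvalConst.continuous_eval_const t)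
  have he (t : unitInterval) : Measurable fun σ : Curve Ω => σ t :=
    (ContinuousEvalConst.continuous_eval_const t).measurable
  refine ⟨Measure.isProbabilityMeasure_map hm.aemeasurable, ?_, ?_, ?_⟩
  · rw [ae_map_iff hm.aemeasurable hL]
    exact .of_forall fun z => exists_lipschitzWith_chainCurve _ _ _ _
  · rw [Measure.map_map (he 0) hm]
    congr 1
    ext1 z
    exact chainCurve_zero _ _ _ _
  · rw [Measure.map_map (he 1) hm]
    congr 1
    ext1 z
    exact chainCurve_one _ _ _ _

/-- Curves that agree at the common time t all pass through the same point, so the mass of their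
indices counts towards its multiplicity. -/
lemma le_curveMultiplicity (hm : Measurable (F.curve hΩ)) (γ : Measure Z) {B : Set Z}
    {z : Z} {t : unitInterval} (h : ∀ z' ∈ B, F.curve hΩ z' t = F.curve hΩ z t) :
    γ B ≤ curveMultiplicity (γ.map (F.curve hΩ)) (F.curve hΩ z t) := by
  refine le_trans (measure_mono fun z' hz' => ?_) (Measure.le_map_apply hm.aemeasurable _)
  exact ⟨t, h z' hz'⟩

/-- This reduces the analysis of curves to combinatorics: only the masses of the classes of
synchronous steps and their lengths remain. -/
theorem branchedDist_le (hΩ : Convex ℝ Ω) (hc : IsCompact Ω) (hx : Measurable x) (hy : Measurable y)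
    {α : ℝ} (h1 : α ≤ 1) (γ : Measure Z) [IsProbabilityMeasure γ]
    {L L' : Type*} [Countable L] [Countable L']
    {B : ℕ → L → Set Z} {b : ℕ → L → ℝ≥0∞} (hB : ∀ n, StepCover F.left n (B n) (b n))
    {B' : ℕ → L' → Set Z} {b' : ℕ → L' → ℝ≥0∞} (hB' : ∀ n, StepCover F.right n (B' n) (b' n)) :
    branchedDist α (γ.map x) (γ.map y) ≤
      ∑' n, (∑' l, γ (B n l) ^ α * b n l + ∑' l, γ (B' n l) ^ α * b' n l) := by
  have hm := F.measurable_curve hΩ hc hx hy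
  have hs (n : ℕ) := measurable_stepBound α γ (hB n).measurableSet (b n)
  have hs' (n : ℕ) := measurable_stepBound α γ (hB' n).measurableSet (b' n)
  refine (iInf₂_le _ (F.isTrafficPlan hΩ hc hx hy γ)).trans ?_
  -- This inequality holds without measurability of the energy integrand.
  refine (lintegral_map_le _ _).trans ?_
  calc _ ≤ ∫⁻ z, ∑' n, (stepBound α γ (B n) (b n) z + stepBound α γ (B' n) (b' n) z) ∂γ := by
        refine lintegral_mono fun z => (lintegral_le_pieces _).trans ?_
        refine ENNReal.tsum_le_tsum fun n => add_le_add ?_ ?_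
        · refine (hB n).le_stepBound α γ z fun c hcz => setLIntegral_leftPiece_le _ _ _ _ h1 _ n ?_
          rintro t ht
          rcases hcz with rfl | ⟨l, hl, rfl⟩
          · exact zero_le
          refine F.le_curveMultiplicity hΩ hm γ fun z' hz' => Subtype.ext ?_
          obtain ⟨e1, e2⟩ := (hB n).eq_of_mem l z' hz' z hl
          rw [curve, curve, chainCurve_of_mem_leftPiece _ _ _ _ ht,
            chainCurve_of_mem_leftPiece _ _ _ _ ht, e1, e2]
        · refine (hB' n).le_stepBound α γ z fun c hcz =>
            setLIntegral_rightPiece_le _ _ _ _ h1 _ n ?_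
          rintro t ht
          rcases hcz with rfl | ⟨l, hl, rfl⟩
          · exact zero_le
          refine F.le_curveMultiplicity hΩ hm γ fun z' hz' => Subtype.ext ?_
          obtain ⟨e1, e2⟩ := (hB' n).eq_of_mem l z' hz' z hl
          rw [curve, curve, chainCurve_of_mem_rightPiece _ _ _ _ ht,
            chainCurve_of_mem_rightPiece _ _ _ _ ht, e1, e2]
    _ = ∑' n, ∫⁻ z, (stepBound α γ (B n) (b n) z + stepBound α γ (B' n) (b' n) z) ∂γ :=
        lintegral_tsum fun n => ((hs n).add (hs' n)).aemeasurable
    _ ≤ _ := by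
        refine ENNReal.tsum_le_tsum fun n => ?_
        rw [lintegral_add_left (hs n)]
        exact add_le_add (lintegral_stepBound_le α γ (hB n).measurableSet _)
          (lintegral_stepBound_le α γ (hB' n).measurableSet _)

end ChainFamily

end BranchedTransport

/-! ### Dyadic cells and the scale of a pair -/

namespace BranchedTransport

open Filter Topology

section Grid

variable {d : ℕ}

/-- The index of the dyadic cell of side `R / 2^k` that contains `x`. -/
noncomputable def cell (R : ℝ) (k : ℕ) (x : E d) : Fin d → ℤ := fun j => ⌊x j * 2 ^ k / R⌋

lemma measurable_cell (R : ℝ) (k : ℕ) : Measurable (cell (d := d) R k) := by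
  refine measurable_pi_lambda _ fun j => Int.measurable_floor.comp ?_
  fun_prop

lemma cell_eq_of_cell_succ_eq {R : ℝ} {k : ℕ} {x y : E d}
    (h : cell R (k + 1) x = cell R (k + 1) y) : cell R k x = cell R k y := by
  -- The dyadic grids are nested: the index of the finer cell determines that of the coarser one.
  have key (a : ℝ) : ⌊a⌋ = ⌊2 * a⌋ / 2 := by
    have h1 := Int.floor_le a
    have h2 := Int.lt_floor_add_one a
    have h3 : 2 * ⌊a⌋ ≤ ⌊2 * a⌋ := Int.le_floor.2 (by push_cast; linarith)
    have h4 : ⌊2 * a⌋ < 2 * ⌊a⌋ + 2 := Int.floor_lt.2 (by push_cast; linarith)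
    omega
  ext j
  have hj := congrFun h j
  simp only [cell] at hj ⊢
  rw [key, key (y j * 2 ^ k / R)]
  rw [show 2 * (x j * 2 ^ k / R) = x j * 2 ^ (k + 1) / R by ring,
    show 2 * (y j * 2 ^ k / R) = y j * 2 ^ (k + 1) / R by ring, hj]

lemma abs_apply_sub_le_dist (x y : E d) (j : Fin d) : |x j - y j| ≤ dist x y := by
  rw [dist_eq_norm]
  exact PiLp.norm_apply_le (x - y) j

lemma dist_le_of_cell_eq {R : ℝ} (hR : 0 < R) {k : ℕ} {x y : E d}
    (h : cell R k x = cell R k y) : dist x y ≤ d * R / 2 ^ k := by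
  have hj (j : Fin d) : dist (x j) (y j) ≤ R / 2 ^ k := by
    have h1 := (Int.abs_sub_lt_one_of_floor_eq_floor (congrFun h j)).le
    rw [Real.dist_eq, le_div_iff₀ (by positivity)]
    rw [← sub_div, ← sub_mul, abs_div, abs_of_pos hR, div_le_one hR, abs_mul,
      abs_of_pos (by positivity : (0 : ℝ) < 2 ^ k)] at h1
    exact h1
  rw [EuclideanSpace.dist_eq, Real.sqrt_le_iff]
  refine ⟨by positivity, ?_⟩
  calc ∑ j, dist (x j) (y j) ^ 2 ≤ ∑ _j : Fin d, (R / 2 ^ k) ^ 2 :=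
        Finset.sum_le_sum fun j _ => pow_le_pow_left₀ dist_nonneg (hj j) 2
    _ = d * (R / 2 ^ k) ^ 2 := by simp
    _ ≤ (d : ℝ) ^ 2 * (R / 2 ^ k) ^ 2 := by
        gcongr
        exact_mod_cast Nat.le_self_pow two_ne_zero d
    _ = (d * R / 2 ^ k) ^ 2 := by ring

lemma cell_mem_Icc {R : ℝ} (hR : 0 < R) {k : ℕ} {x y : E d} {m : ℕ}
    (h : dist x y * 2 ^ k ≤ m * R) (j : Fin d) :
    cell R k y j ∈ Finset.Icc (cell R k x j - m) (cell R k x j + m) := by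
  have h1 : |x j * 2 ^ k / R - y j * 2 ^ k / R| ≤ m := by
    rw [← sub_div, ← sub_mul, abs_div, abs_of_pos hR, div_le_iff₀ hR, abs_mul,
      abs_of_pos (by positivity : (0 : ℝ) < 2 ^ k)]
    exact (mul_le_mul_of_nonneg_right (abs_apply_sub_le_dist x y j) (by positivity)).trans h
  rw [abs_le] at h1
  rw [Finset.mem_Icc]
  simp only [cell]
  constructor
  · rw [Int.le_floor]
    push_cast
    linarith [Int.floor_le (x j * 2 ^ k / R)]
  · rw [← Int.floor_add_natCast]
    exact Int.floor_le_floor (by linarith)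

/-- The indices of the cells that are at most `m` cells away from the cell `h`. -/
noncomputable def nearCells (m : ℕ) (h : Fin d → ℤ) : Finset (Fin d → ℤ) :=
  Fintype.piFinset fun j => Finset.Icc (h j - m) (h j + m)

lemma card_nearCells (m : ℕ) (h : Fin d → ℤ) : (nearCells m h).card = (2 * m + 1) ^ d := by
  have (j : Fin d) : (Finset.Icc (h j - m) (h j + m)).card = 2 * m + 1 := by
    rw [Int.card_Icc]; omega
  simp [nearCells, Fintype.card_piFinset, this]

variable {Ω : Set (E d)} [Nonempty Ω]

/-- A point of `Ω` in the same dyadic cell as `x`. -/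
noncomputable def center (R : ℝ) (k : ℕ) (x : Ω) : Ω :=
  Function.invFun (fun y : Ω => cell R k (y : E d)) (cell R k (x : E d))

lemma cell_center (R : ℝ) (k : ℕ) (x : Ω) : cell R k (center R k x : E d) = cell R k (x : E d) :=
  Function.apply_invFun_apply (f := fun y : Ω => cell R k (y : E d))

lemma center_congr {R : ℝ} {k : ℕ} {x y : Ω} (h : cell R k (x : E d) = cell R k (y : E d)) :
    center R k x = center R k y := by
  rw [center, h, center]

lemma measurable_center (R : ℝ) (k : ℕ) : Measurable (center (Ω := Ω) R k) :=
  (Measurable.of_discrete (f := Function.invFun (fun y : Ω => cell R k (y : E d)))).comp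
    ((measurable_cell R k).comp measurable_subtype_coe)

lemma dist_center_le {R : ℝ} (hR : 0 < R) (k : ℕ) (x : Ω) :
    dist (center R k x) x ≤ d * R / 2 ^ k :=
  dist_le_of_cell_eq hR (cell_center R k x)

lemma dist_center_succ_le {R : ℝ} (hR : 0 < R) (k : ℕ) (x : Ω) :
    dist (center R (k + 1) x) (center R k x) ≤ 2 * d * R / 2 ^ k := by
  refine (dist_triangle_right _ _ x).trans ?_
  have h1 := dist_center_le hR (k + 1) x
  have h2 := dist_center_le hR k x
  have h3 : d * R / 2 ^ (k + 1) ≤ d * R / 2 ^ k := by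
    gcongr
    · norm_num
    · omega
  calc _ ≤ d * R / 2 ^ k + d * R / 2 ^ k := by linarith
    _ = _ := by ring

end Grid

section Scale

variable {d : ℕ} {Ω : Set (E d)}

/-- The integer `i` such that `R / 2^(i+1) < |x - y| ≤ R / 2^i`. -/
noncomputable def scale (R : ℝ) (z : Ω × Ω) : ℕ := Nat.log 2 ⌊R / dist z.1 z.2⌋₊

lemma measurable_scale (R : ℝ) : Measurable (scale (Ω := Ω) R) :=
  (Measurable.of_discrete (f := Nat.log 2)).comp
    (Nat.measurable_floor.comp (measurable_const.div (measurable_fst.dist measurable_snd)))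

lemma dist_mul_two_pow_scale_le {R : ℝ} {z : Ω × Ω} (hz : z.1 ≠ z.2)
    (h : dist z.1 z.2 ≤ R) : dist z.1 z.2 * 2 ^ scale R z ≤ R := by
  have h0 := dist_pos.2 hz
  have h1 : 1 ≤ R / dist z.1 z.2 := (one_le_div h0).2 h
  have h2 : 2 ^ scale R z ≤ ⌊R / dist z.1 z.2⌋₊ :=
    Nat.pow_log_le_self 2 (Nat.floor_pos.2 h1).ne'
  have h3 : (2 : ℝ) ^ scale R z ≤ R / dist z.1 z.2 := by
    refine le_trans ?_ (Nat.floor_le (by linarith))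
    exact_mod_cast h2
  rw [le_div_iff₀ h0] at h3
  linarith

lemma lt_dist_mul_two_pow_scale {R : ℝ} {z : Ω × Ω} (hz : z.1 ≠ z.2) :
    R < dist z.1 z.2 * 2 ^ (scale R z + 1) := by
  have h0 := dist_pos.2 hz
  have h2 : ⌊R / dist z.1 z.2⌋₊ < 2 ^ (scale R z + 1) := Nat.lt_pow_succ_log_self (by norm_num) _
  have h3 := Nat.lt_of_floor_lt h2
  rw [div_lt_iff₀ h0] at h3
  push_cast at h3
  linarith

end Scale

end BranchedTransport

/-! ### Dyadic chains joining the two points of a pair -/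

namespace BranchedTransport

open Filter Topology

variable {d : ℕ} {Ω : Set (E d)}

lemma IsChain.of_dist_le {q : ℕ → Ω} {x : Ω} {B B' : ℝ}
    (h : ∀ n, dist (q (n + 1)) (q n) ≤ B / 2 ^ n) (h' : ∀ n, dist (q n) x ≤ B' / 2 ^ n) :
    IsChain (fun n => (q n : E d)) x where
  bound := ⟨B, fun n => by
    rw [← dist_eq_norm, ← Subtype.dist_eq]
    refine (h n).trans (le_of_eq ?_)
    rw [one_div, inv_pow, div_eq_mul_inv]⟩
  tendsto := by
    rw [tendsto_iff_dist_tendsto_zero]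
    refine squeeze_zero (fun _ => dist_nonneg) (fun n => h' n) ?_
    have := (tendsto_pow_atTop_nhds_zero_of_lt_one (r := (1 / 2 : ℝ)) (by norm_num)
      (by norm_num)).const_mul B'
    rw [mul_zero] at this
    refine this.congr fun n => ?_
    rw [one_div, inv_pow, div_eq_mul_inv]

variable [Nonempty Ω]

open Classical in
/-- The chain from the centre of the cell of `z.1` at the scale of `z` to the point `z.1`. -/
noncomputable def leftChain (R : ℝ) (z : Ω × Ω) (n : ℕ) : Ω :=
  if z.1 = z.2 then z.1 else center R (scale R z + n) z.1

open Classical in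
/-- The chain from the centre of the cell of `z.1` at the scale of `z`, through the centre of the
cell of `z.2` at this scale, to the point `z.2`. -/
noncomputable def rightChain (R : ℝ) (z : Ω × Ω) (n : ℕ) : Ω :=
  if z.1 = z.2 then z.1 else
    n.casesOn (center R (scale R z) z.1) fun m => center R (scale R z + m) z.2

lemma leftChain_of_eq (R : ℝ) {z : Ω × Ω} (hz : z.1 = z.2) (n : ℕ) : leftChain R z n = z.1 :=
  if_pos hz

lemma leftChain_of_ne (R : ℝ) {z : Ω × Ω} (hz : z.1 ≠ z.2) (n : ℕ) :
    leftChain R z n = center R (scale R z + n) z.1 :=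
  if_neg hz

lemma rightChain_of_eq (R : ℝ) {z : Ω × Ω} (hz : z.1 = z.2) (n : ℕ) : rightChain R z n = z.1 :=
  if_pos hz

lemma rightChain_zero (R : ℝ) {z : Ω × Ω} (hz : z.1 ≠ z.2) :
    rightChain R z 0 = center R (scale R z) z.1 :=
  if_neg hz

lemma rightChain_succ (R : ℝ) {z : Ω × Ω} (hz : z.1 ≠ z.2) (n : ℕ) :
    rightChain R z (n + 1) = center R (scale R z + n) z.2 :=
  if_neg hz

lemma measurable_center_scale (R : ℝ) (n : ℕ) {f : Ω × Ω → Ω} (hf : Measurable f) :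
    Measurable fun z : Ω × Ω => center R (scale R z + n) (f z) := by
  let g : Ω × ℕ → Ω := fun w => center R (w.2 + n) w.1
  have hg : Measurable g :=
    measurable_from_prod_countable_left fun k => measurable_center R (k + n)
  change Measurable (g ∘ fun z => (f z, scale R z))
  exact hg.comp (hf.prodMk (measurable_scale R))

lemma measurable_leftChain (R : ℝ) (n : ℕ) :
    Measurable fun z : Ω × Ω => leftChain R z n :=
  Measurable.ite (measurableSet_eq_fun measurable_fst measurable_snd) measurable_fst
    (measurable_center_scale R n measurable_fst)

lemma measurable_rightChain (R : ℝ) (n : ℕ) :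
    Measurable fun z : Ω × Ω => rightChain R z n := by
  refine Measurable.ite (measurableSet_eq_fun measurable_fst measurable_snd) measurable_fst ?_
  cases n with
  | zero => exact measurable_center_scale R 0 measurable_fst
  | succ m => exact measurable_center_scale R m measurable_snd

lemma dist_leftChain_le {R : ℝ} (hR : 0 < R) (z : Ω × Ω) (n : ℕ) :
    dist (leftChain R z (n + 1)) (leftChain R z n) ≤
    (4 * d + 1) * R / 2 ^ (scale R z + n) := by
  by_cases hz : z.1 = z.2
  · rw [leftChain_of_eq R hz, leftChain_of_eq R hz, dist_self]
    positivity
  · rw [leftChain_of_ne R hz, leftChain_of_ne R hz]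
    refine (dist_center_succ_le hR (scale R z + n) _).trans ?_
    have : (0 : ℝ) ≤ d * R := by positivity
    exact div_le_div_of_nonneg_right (by linarith) (by positivity)

/-- Step 0 is the crossing, with constant 2d+1. It delays the descent by one index, which doubles
the constant 2d of the later steps; 4d+1 covers both. -/
lemma dist_rightChain_le {R : ℝ} (hR : 0 < R) {z : Ω × Ω} (h : dist z.1 z.2 ≤ R) (n : ℕ) :
    dist (rightChain R z (n + 1)) (rightChain R z n) ≤
      (4 * d + 1) * R / 2 ^ (scale R z + n) := by
  have hd : (0 : ℝ) ≤ d := by positivity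
  by_cases hz : z.1 = z.2
  · rw [rightChain_of_eq R hz, rightChain_of_eq R hz, dist_self]
    positivity
  cases n with
  | zero =>
    rw [rightChain_zero R hz, rightChain_succ R hz, add_zero]
    have h1 := dist_center_le hR (scale R z) z.1
    have h2 := dist_center_le hR (scale R z) z.2
    have h3 : dist z.1 z.2 ≤ R / 2 ^ scale R z := by
      rw [le_div_iff₀ (by positivity)]
      exact dist_mul_two_pow_scale_le hz h
    calc _ ≤ dist (center R (scale R z) z.2) z.2 + dist z.2 z.1 +
          dist z.1 (center R (scale R z) z.1) := dist_triangle4 _ _ _ _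
      _ ≤ d * R / 2 ^ scale R z + R / 2 ^ scale R z + d * R / 2 ^ scale R z := by
          rw [dist_comm z.2, dist_comm z.1 (center _ _ _)]
          gcongr
      _ = (2 * d + 1) * R / 2 ^ scale R z := by ring
      _ ≤ _ := by gcongr; norm_num
  | succ m =>
    rw [rightChain_succ R hz, rightChain_succ R hz]
    refine (dist_center_succ_le hR (scale R z + m) _).trans ?_
    rw [← add_assoc, pow_succ _ (scale R z + m), div_le_div_iff₀ (by positivity) (by positivity)]
    have : 0 < R * 2 ^ (scale R z + m) := by positivity
    nlinarith

/-- The chains that define the traffic plan associated with a transport plan. -/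
noncomputable def dyadicFamily {R : ℝ} (hR : 0 < R) (h : ∀ x y : Ω, dist x y ≤ R) :
    ChainFamily (Prod.fst : Ω × Ω → Ω) Prod.snd where
  left := leftChain R
  right := rightChain R
  measurable_left := measurable_leftChain R
  measurable_right := measurable_rightChain R
  isChain_left z := by
    refine .of_dist_le (B := (4 * d + 1) * R / 2 ^ scale R z) (B' := d * R) (fun n => ?_)
      fun n => ?_
    · rw [div_div, ← pow_add]
      exact dist_leftChain_le hR z n
    · by_cases hz : z.1 = z.2
      · rw [leftChain_of_eq R hz, dist_self]; positivity
      · rw [leftChain_of_ne R hz]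
        refine (dist_center_le hR _ _).trans ?_
        gcongr
        · norm_num
        · omega
  isChain_right z := by
    refine .of_dist_le (B := (4 * d + 1) * R / 2 ^ scale R z) (B' := (2 * d + 1) * R)
      (fun n => ?_) fun n => ?_
    · rw [div_div, ← pow_add]
      exact dist_rightChain_le hR (h _ _) n
    · by_cases hz : z.1 = z.2
      · rw [rightChain_of_eq R hz, hz, dist_self]; positivity
      cases n with
      | zero =>
        rw [rightChain_zero R hz, pow_zero, div_one]
        refine (dist_triangle _ z.1 _).trans ?_
        have h1 := dist_center_le hR (scale R z) z.1
        have h2 : d * R / 2 ^ scale R z ≤ d * R :=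
          div_le_self (by positivity) (one_le_pow₀ (by norm_num))
        have h3 := h z.1 z.2
        have : 0 ≤ d * R := by positivity
        linarith
      | succ m =>
        rw [rightChain_succ R hz]
        refine (dist_center_le hR _ _).trans ?_
        calc d * R / 2 ^ (scale R z + m) ≤ d * R / 2 ^ m := by
              gcongr
              · norm_num
              · omega
          _ = 2 * d * R / 2 ^ (m + 1) := by rw [pow_succ]; field_simp
          _ ≤ _ := by gcongr; linarith
  left_zero z := by
    by_cases hz : z.1 = z.2
    · rw [leftChain_of_eq R hz, rightChain_of_eq R hz]
    · rw [leftChain_of_ne R hz, rightChain_zero R hz, add_zero]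

end BranchedTransport

/-! ### Classes of synchronous steps and their number -/

namespace BranchedTransport

open Filter Topology

/-- This is the power mean inequality with exponent 1/α ≥ 1 applied to the numbers m i ^ α. -/
lemma sum_rpow_le_card_mul_rpow_sum {ι : Type*} (s : Finset ι) (m : ι → ℝ≥0∞) {α : ℝ}
    (h0 : 0 < α) (h1 : α ≤ 1) :
    ∑ i ∈ s, m i ^ α ≤ (s.card : ℝ≥0∞) ^ (1 - α) * (∑ i ∈ s, m i) ^ α := by
  have h := ENNReal.rpow_sum_le_const_mul_sum_rpow s (fun i => m i ^ α)
    (p := 1 / α) ((one_le_div h0).2 h1)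
  simp only [← ENNReal.rpow_mul, mul_one_div_cancel h0.ne', ENNReal.rpow_one] at h
  have h' := ENNReal.rpow_le_rpow h h0.le
  rwa [← ENNReal.rpow_mul, one_div_mul_cancel h0.ne', ENNReal.rpow_one,
    ENNReal.mul_rpow_of_nonneg _ _ h0.le, ← ENNReal.rpow_mul,
    show (1 / α - 1) * α = 1 - α by field_simp] at h'

variable {d : ℕ} {Ω : Set (E d)}

/-- The pairs of distinct points at scale `i`. -/
def scaleSet (Ω : Set (E d)) (R : ℝ) (i : ℕ) : Set (Ω × Ω) := {z | z.1 ≠ z.2 ∧ scale R z = i}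

lemma measurableSet_scaleSet (R : ℝ) (i : ℕ) : MeasurableSet (scaleSet Ω R i) :=
  (measurableSet_eq_fun measurable_fst measurable_snd).compl.inter
    (measurable_scale R (measurableSet_singleton i))

lemma pairwise_disjoint_scaleSet (R : ℝ) : Pairwise (Function.onFun Disjoint (scaleSet Ω R)) :=
  fun _ _ hij => Set.disjoint_left.2 fun _ hz hz' => hij (hz.2.symm.trans hz'.2)

/-- The pairs of distinct points with given scale and label. -/
def labelSet {G : Type*} (R : ℝ) (g : Ω × Ω → G) (l : ℕ × G) : Set (Ω × Ω) :=
  scaleSet Ω R l.1 ∩ g ⁻¹' {l.2}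

lemma tsum_labelSet_le {G : Type*} [MeasurableSpace G] [MeasurableSingletonClass G]
    (γ : Measure (Ω × Ω)) {α : ℝ} (h0 : 0 < α) (h1 : α ≤ 1) {R : ℝ} {g : Ω × Ω → G}
    (hg : Measurable g) (b : ℕ → ℝ≥0∞) (N : ℕ → ℕ)
    (hN : ∀ i, ∃ S : Finset G, S.card ≤ N i ∧ ∀ z ∈ scaleSet Ω R i, g z ∈ S) :
    ∑' l : ℕ × G, γ (labelSet R g l) ^ α * b l.1 ≤
      ∑' i, b i * (N i : ℝ≥0∞) ^ (1 - α) * γ (scaleSet Ω R i) ^ α := by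
  rw [ENNReal.tsum_prod']
  refine ENNReal.tsum_le_tsum fun i => ?_
  obtain ⟨S, hS, hgS⟩ := hN i
  change ∑' l : G, γ (labelSet R g (i, l)) ^ α * b i ≤ _
  rw [ENNReal.tsum_mul_right, mul_comm, mul_assoc]
  refine mul_le_mul' le_rfl ?_
  have hz : ∀ l ∉ S, γ (labelSet R g (i, l)) ^ α = 0 := by
    intro l hl
    have : labelSet R g (i, l) = ∅ :=
      eq_empty_of_forall_notMem fun z hz => hl ((show g z = l from hz.2) ▸ hgS z hz.1)
    rw [this, measure_empty, ENNReal.zero_rpow_of_pos h0]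
  rw [tsum_eq_sum hz]
  refine (sum_rpow_le_card_mul_rpow_sum S _ h0 h1).trans (mul_le_mul' ?_ ?_)
  · exact ENNReal.rpow_le_rpow (by exact_mod_cast hS) (by linarith)
  · refine ENNReal.rpow_le_rpow ?_ h0.le
    rw [← measure_biUnion_finset]
    · exact measure_mono (iUnion₂_subset fun l _ => inter_subset_left)
    · exact fun l _ l' _ hll => Set.disjoint_left.2 fun z hz hz' => hll (hz.2.symm.trans hz'.2)
    · exact fun l _ => (measurableSet_scaleSet R i).inter (hg (measurableSet_singleton l))

/-- The label that determines the `n`-th step of `leftChain`. -/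
noncomputable def leftLabel (R : ℝ) (n : ℕ) (z : Ω × Ω) : (Fin d → ℤ) × (Fin d → ℤ) :=
  (cell R (scale R z + n + 1) (z.1 : E d), 0)

/-- The label that determines the `n`-th step of `rightChain`. -/
noncomputable def rightLabel (R : ℝ) (n : ℕ) (z : Ω × Ω) : (Fin d → ℤ) × (Fin d → ℤ) :=
  n.casesOn (cell R (scale R z) (z.1 : E d),
      cell R (scale R z) (z.2 : E d) - cell R (scale R z) (z.1 : E d))
    fun m => (cell R (scale R z + m + 1) (z.2 : E d), 0)

lemma rightLabel_zero (R : ℝ) (z : Ω × Ω) : rightLabel R 0 z = (cell R (scale R z) (z.1 : E d),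
    cell R (scale R z) (z.2 : E d) - cell R (scale R z) (z.1 : E d)) := rfl

lemma rightLabel_succ (R : ℝ) (n : ℕ) (z : Ω × Ω) :
    rightLabel R (n + 1) z = (cell R (scale R z + n + 1) (z.2 : E d), 0) := rfl

lemma measurable_cell_scale (R : ℝ) (n : ℕ) {f : Ω × Ω → Ω} (hf : Measurable f) :
    Measurable fun z : Ω × Ω => cell R (scale R z + n) (f z : E d) := by
  let g : E d × ℕ → Fin d → ℤ := fun w => cell R (w.2 + n) w.1
  have hg : Measurable g :=
    measurable_from_prod_countable_left fun k => measurable_cell R (k + n)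
  change Measurable (g ∘ fun z => ((f z : E d), scale R z))
  exact hg.comp ((measurable_subtype_coe.comp hf).prodMk (measurable_scale R))

lemma measurable_leftLabel (R : ℝ) (n : ℕ) : Measurable (leftLabel (Ω := Ω) R n) :=
  (measurable_cell_scale R (n + 1) measurable_fst).prodMk measurable_const

lemma measurable_rightLabel (R : ℝ) (n : ℕ) : Measurable (rightLabel (Ω := Ω) R n) := by
  cases n with
  | zero =>
    have h1 := measurable_cell_scale (Ω := Ω) R 0 measurable_fst
    have h2 := measurable_cell_scale (Ω := Ω) R 0 measurable_snd
    exact h1.prodMk (h2.sub h1)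
  | succ m => exact (measurable_cell_scale R (m + 1) measurable_snd).prodMk measurable_const

/-- A bound of the length of the steps of index `n` at scale `i`. -/
noncomputable def stepLength (d : ℕ) (R : ℝ) (n i : ℕ) : ℝ≥0∞ :=
  ENNReal.ofReal ((4 * d + 1) * R) * 2⁻¹ ^ (i + n)

lemma edist_le_stepLength {R : ℝ} {n i : ℕ} {x y : Ω}
    (h : dist y x ≤ (4 * d + 1) * R / 2 ^ (i + n)) : edist x y ≤ stepLength d R n i := by
  rw [edist_comm, edist_dist, stepLength]
  refine (ENNReal.ofReal_le_ofReal h).trans_eq ?_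
  rw [ENNReal.ofReal_div_of_pos (by positivity), div_eq_mul_inv, ← ENNReal.inv_pow,
    ENNReal.ofReal_pow zero_le_two, ENNReal.ofReal_ofNat]

section StepCover

variable [Nonempty Ω] {R : ℝ}

lemma stepCover_leftChain (hR : 0 < R) (n : ℕ) :
    StepCover (leftChain (Ω := Ω) R) n (labelSet R (leftLabel R n))
      (fun l => stepLength d R n l.1) where
  measurableSet l := (measurableSet_scaleSet R l.1).inter
    (measurable_leftLabel R n (measurableSet_singleton l.2))
  eq_of_mem := by
    rintro ⟨i, l⟩ z ⟨⟨hz, hi⟩, hl⟩ z' ⟨⟨hz', hi'⟩, hl'⟩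
    have h := congrArg Prod.fst (hl.trans hl'.symm)
    simp only [leftLabel] at h
    rw [show scale R z = i from hi, show scale R z' = i from hi'] at h
    rw [leftChain_of_ne R hz, leftChain_of_ne R hz', leftChain_of_ne R hz,
      leftChain_of_ne R hz', show scale R z = i from hi, show scale R z' = i from hi']
    -- The label records only the finer cell, which fixes both ends of the step.
    exact ⟨center_congr (cell_eq_of_cell_succ_eq h), center_congr h⟩
  edist_le := by
    rintro ⟨i, l⟩ z ⟨⟨hz, hi⟩, hl⟩
    change scale R z = i at hi
    exact edist_le_stepLength (hi ▸ dist_leftChain_le hR z n)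
  eq_of_notMem z hz := by
    by_cases h : z.1 = z.2
    · rw [leftChain_of_eq R h, leftChain_of_eq R h]
    · refine absurd (mem_iUnion.2 ⟨(scale R z, leftLabel R n z), ?_⟩) hz
      exact ⟨⟨h, rfl⟩, rfl⟩

lemma stepCover_rightChain (hR : 0 < R) (hΩ : ∀ x y : Ω, dist x y ≤ R) (n : ℕ) :
    StepCover (rightChain (Ω := Ω) R) n (labelSet R (rightLabel R n))
      (fun l => stepLength d R n l.1) where
  measurableSet l := (measurableSet_scaleSet R l.1).inter
    (measurable_rightLabel R n (measurableSet_singleton l.2))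
  eq_of_mem := by
    rintro ⟨i, l⟩ z ⟨⟨hz, hi⟩, hl⟩ z' ⟨⟨hz', hi'⟩, hl'⟩
    change scale R z = i at hi
    change scale R z' = i at hi'
    have h : rightLabel R n z = rightLabel R n z' := hl.trans hl'.symm
    cases n with
    | zero =>
      rw [rightLabel_zero, rightLabel_zero, Prod.mk.injEq, hi, hi'] at h
      obtain ⟨h1, h2⟩ := h
      rw [h1, sub_left_inj] at h2
      rw [rightChain_zero R hz, rightChain_zero R hz', rightChain_succ R hz,
        rightChain_succ R hz', hi, hi']
      exact ⟨center_congr h1, center_congr h2⟩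
    | succ m =>
      simp only [rightLabel_succ, Prod.mk.injEq, hi, hi', and_true] at h
      rw [rightChain_succ R hz, rightChain_succ R hz', rightChain_succ R hz,
        rightChain_succ R hz', hi, hi']
      exact ⟨center_congr (cell_eq_of_cell_succ_eq h), center_congr h⟩
  edist_le := by
    rintro ⟨i, l⟩ z ⟨⟨hz, hi⟩, hl⟩
    change scale R z = i at hi
    exact edist_le_stepLength (hi ▸ dist_rightChain_le hR (hΩ _ _) n)
  eq_of_notMem z hz := by
    by_cases h : z.1 = z.2
    · rw [rightChain_of_eq R h, rightChain_of_eq R h]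
    · refine absurd (mem_iUnion.2 ⟨(scale R z, rightLabel R n z), ?_⟩) hz
      exact ⟨⟨h, rfl⟩, rfl⟩

end StepCover

section Counting

variable {R : ℝ}

lemma cell_mem_nearCells (hR : 0 < R) (hΩ : ∀ x y : Ω, dist x y ≤ R) (k : ℕ) (x y : Ω) :
    cell R k (y : E d) ∈ nearCells (2 ^ k) (cell R k (x : E d)) := by
  refine Fintype.mem_piFinset.2 fun j => cell_mem_Icc hR ?_ j
  have := hΩ x y
  rw [Subtype.dist_eq] at this
  push_cast
  rw [mul_comm]
  gcongr

/-- In each coordinate there are at most (2·2^k + 1)·3 ≤ (4·2^i + 1)·3 ≤ 15·2^i choices. The factor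
3 is for the offset of the crossing, which is 0 for all other steps. -/
lemma card_labels_le {k i : ℕ} (hk : k ≤ i + 1) (h : Fin d → ℤ) :
    (nearCells (2 ^ k) h ×ˢ nearCells 1 (0 : Fin d → ℤ)).card ≤ 15 ^ d * (2 ^ i) ^ d := by
  rw [Finset.card_product, card_nearCells, card_nearCells, ← mul_pow, ← mul_pow]
  refine Nat.pow_le_pow_left ?_ d
  have h1 : 2 ^ k ≤ 2 * 2 ^ i := by
    rw [← pow_succ']; exact Nat.pow_le_pow_right two_pos hk
  have h2 : 1 ≤ 2 ^ i := Nat.one_le_two_pow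
  omega

lemma exists_leftLabels (hR : 0 < R) (hΩ : ∀ x y : Ω, dist x y ≤ R) (x₀ : Ω) (n i : ℕ) :
    ∃ S : Finset ((Fin d → ℤ) × (Fin d → ℤ)), S.card ≤ 15 ^ d * (2 ^ (i + n)) ^ d ∧
      ∀ z ∈ scaleSet Ω R i, leftLabel R n z ∈ S := by
  refine ⟨_, card_labels_le le_rfl (cell R (i + n + 1) (x₀ : E d)), fun z hz => ?_⟩
  obtain ⟨-, rfl⟩ := hz
  refine Finset.mem_product.2 ⟨cell_mem_nearCells hR hΩ _ _ _, ?_⟩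
  simp [leftLabel, nearCells]

lemma exists_rightLabels (hR : 0 < R) (hΩ : ∀ x y : Ω, dist x y ≤ R) (x₀ : Ω) (n i : ℕ) :
    ∃ S : Finset ((Fin d → ℤ) × (Fin d → ℤ)), S.card ≤ 15 ^ d * (2 ^ (i + n)) ^ d ∧
      ∀ z ∈ scaleSet Ω R i, rightLabel R n z ∈ S := by
  refine ⟨_, card_labels_le (Nat.le_succ _) (cell R (i + n) (x₀ : E d)), fun z hz => ?_⟩
  obtain ⟨hz, rfl⟩ := hz
  refine Finset.mem_product.2 ?_
  cases n with
  | zero =>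
    refine ⟨cell_mem_nearCells hR hΩ _ _ _, Fintype.mem_piFinset.2 fun j => ?_⟩
    -- At the scale of the pair, the distance is at most one cell side, so the crossing joins cells
    -- whose indices differ by at most 1 in each coordinate.
    have h := cell_mem_Icc hR (k := scale R z) (x := (z.1 : E d)) (y := z.2) (m := 1)
      (by simpa [Subtype.dist_eq] using dist_mul_two_pow_scale_le hz (hΩ _ _)) j
    rw [Finset.mem_Icc] at h ⊢
    simp only [rightLabel_zero, Pi.sub_apply, Pi.zero_apply]
    constructor <;> linarith [h.1, h.2]
  | succ m =>
    refine ⟨cell_mem_nearCells hR hΩ _ _ _, ?_⟩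
    simp [rightLabel_succ, nearCells]

end Counting

theorem branchedDist_le_tsum_scaleSet (hc : IsCompact Ω) (hΩ : Convex ℝ Ω) {R : ℝ} (hR : 0 < R)
    (hD : ∀ x y : Ω, dist x y ≤ R) {α : ℝ} (h0 : 0 < α) (h1 : α ≤ 1) {μ₀ μ₁ : Measure Ω}
    (γ : Measure (Ω × Ω)) [IsProbabilityMeasure γ] (hγ : IsTransportPlan μ₀ μ₁ γ) :
    branchedDist α μ₀ μ₁ ≤ ∑' n, ∑' i, 2 * (stepLength d R n i *
      ((15 ^ d * (2 ^ (i + n)) ^ d : ℕ) : ℝ≥0∞) ^ (1 - α) * γ (scaleSet Ω R i) ^ α) := by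
  obtain ⟨z₀⟩ := nonempty_of_isProbabilityMeasure γ
  have : Nonempty Ω := ⟨z₀.1⟩
  have h := (dyadicFamily hR hD).branchedDist_le hΩ hc measurable_fst measurable_snd h1 γ
    (fun n => stepCover_leftChain hR n) (fun n => stepCover_rightChain hR hD n)
  rw [hγ.map_fst, hγ.map_snd] at h
  refine h.trans (ENNReal.tsum_le_tsum fun n => ?_)
  rw [ENNReal.tsum_mul_left, two_mul]
  exact add_le_add
    (tsum_labelSet_le γ h0 h1 (measurable_leftLabel R n) (stepLength d R n) _
      (exists_leftLabels hR hD z₀.1 n))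
    (tsum_labelSet_le γ h0 h1 (measurable_rightLabel R n) (stepLength d R n) _
      (exists_rightLabels hR hD z₀.1 n))

end BranchedTransport

/-! ### Summation over the scales -/

namespace BranchedTransport

open Filter Topology

lemma two_rpow_neg_lt_one {β : ℝ} (hβ : 0 < β) : (2 : ℝ≥0∞) ^ (-β) < 1 :=
  ENNReal.rpow_lt_one_of_one_lt_of_neg ENNReal.one_lt_two (by linarith)

lemma inv_one_sub_two_rpow_neg_ne_top {β : ℝ} (hβ : 0 < β) :
    (1 - (2 : ℝ≥0∞) ^ (-β))⁻¹ ≠ ⊤ :=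
  ENNReal.inv_ne_top.2 (tsub_pos_of_lt (two_rpow_neg_lt_one hβ)).ne'

lemma exists_two_pow_mul_le {u : ℝ≥0∞} (h0 : u ≠ 0) (h1 : u ≤ 1) :
    ∃ n : ℕ, 2 ^ n * u ≤ 1 ∧ 1 ≤ 2 ^ (n + 1) * u := by
  have ht : u ≠ ⊤ := (h1.trans_lt ENNReal.one_lt_top).ne
  lift u to ℝ≥0 using ht
  have h0' : 0 < u := pos_iff_ne_zero.2 (by exact_mod_cast h0)
  have h1' : u ≤ 1 := by exact_mod_cast h1
  obtain ⟨n, hn, hn'⟩ := exists_nat_pow_near ((one_le_inv₀ h0').2 h1')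
    (show (1 : ℝ≥0) < 2 by norm_num)
  rw [← one_div, le_div_iff₀ h0'] at hn
  rw [← one_div, div_lt_iff₀ h0'] at hn'
  exact ⟨n, by exact_mod_cast hn, by exact_mod_cast hn'.le⟩

/-- Let 2^n u be about 1. Up to n the bound 2^i u makes the terms grow like 2^((1-β)i), so the last
one dominates; after n the bound 1 makes them decay like 2^(-βi). Both geometric series are O(u^β).
-/
lemma tsum_geometric_mul_le {β : ℝ} (h0 : 0 < β) (h1 : β < 1) {u : ℝ≥0∞} {m : ℕ → ℝ≥0∞}
    (hm : ∀ i, m i ≤ 1) (hmu : ∀ i, m i ≤ 2 ^ i * u) :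
    ∑' i, ((2 : ℝ≥0∞) ^ (-β)) ^ i * m i ≤
      ((1 - (2 : ℝ≥0∞) ^ (-(1 - β)))⁻¹ + (1 - (2 : ℝ≥0∞) ^ (-β))⁻¹) * u ^ β := by
  rcases eq_or_ne u 0 with rfl | hu0
  · have (i : ℕ) : m i = 0 := by simpa using hmu i
    simp [this]
  rcases le_total 1 u with hu | hu
  · calc _ ≤ ∑' i, ((2 : ℝ≥0∞) ^ (-β)) ^ i :=
          ENNReal.tsum_le_tsum fun i => mul_le_of_le_one_right' (hm i)
      _ = (1 - (2 : ℝ≥0∞) ^ (-β))⁻¹ * 1 := by rw [ENNReal.tsum_geometric, mul_one]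
      _ ≤ _ := mul_le_mul' le_add_self (ENNReal.one_le_rpow hu h0)
  have hut : u ≠ ⊤ := (hu.trans_lt ENNReal.one_lt_top).ne
  obtain ⟨n, hn, hn'⟩ := exists_two_pow_mul_le hu0 hu
  rw [← ENNReal.summable.sum_add_tsum_nat_add' (k := n + 1), add_mul]
  refine add_le_add ?_ ?_
  · have hκ (k : ℕ) : ((2 : ℝ≥0∞) ^ (-β)) ^ k * 2 ^ k = ((2 : ℝ≥0∞) ^ (1 - β)) ^ k := by
      rw [← mul_pow]
      congr 1
      conv_lhs => rw [← ENNReal.rpow_one 2, ← ENNReal.rpow_mul, one_mul,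
        ← ENNReal.rpow_add _ _ two_ne_zero ENNReal.ofNat_ne_top]
      congr 1
      ring
    have hn1 : ((2 : ℝ≥0∞) ^ (1 - β)) ^ n * u ≤ u ^ β := by
      calc ((2 : ℝ≥0∞) ^ (1 - β)) ^ n * u = (2 ^ n * u) ^ (1 - β) * u ^ β := by
            rw [ENNReal.mul_rpow_of_nonneg _ _ (by linarith), mul_assoc,
              ← ENNReal.rpow_add _ _ hu0 hut, sub_add_cancel, ENNReal.rpow_one,
              ← ENNReal.rpow_natCast, ← ENNReal.rpow_natCast, ← ENNReal.rpow_mul,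
              ← ENNReal.rpow_mul, mul_comm (n : ℝ)]
        _ ≤ 1 * u ^ β := by
            gcongr
            exact ENNReal.rpow_le_one hn (by linarith)
        _ = u ^ β := one_mul _
    calc _ ≤ ∑ i ∈ Finset.range (n + 1), ((2 : ℝ≥0∞) ^ (-(1 - β))) ^ (n - i) * u ^ β := by
          refine Finset.sum_le_sum fun i hi => ?_
          rw [Finset.mem_range, Nat.lt_succ_iff] at hi
          refine (mul_le_mul' le_rfl (hmu i)).trans ?_
          rw [← mul_assoc, hκ]
          refine le_trans (le_of_eq ?_) (mul_le_mul' le_rfl hn1)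
          rw [← mul_assoc]
          congr 1
          obtain ⟨k, rfl⟩ := Nat.exists_eq_add_of_le hi
          rw [Nat.add_sub_cancel_left, pow_add, mul_left_comm, ← mul_pow,
            ENNReal.rpow_neg, ENNReal.inv_mul_cancel (by simp) (by simp), one_pow, mul_one]
      _ = (∑ i ∈ Finset.range (n + 1), ((2 : ℝ≥0∞) ^ (-(1 - β))) ^ i) * u ^ β := by
          rw [← Finset.sum_mul, ← Finset.sum_range_reflect]
          congr 1
          refine Finset.sum_congr rfl fun i hi => ?_
          rw [Finset.mem_range] at hi
          congr 1
          omega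
      _ ≤ _ := by
          gcongr
          rw [← ENNReal.tsum_geometric]
          exact ENNReal.sum_le_tsum _
  · calc _ ≤ ∑' i, ((2 : ℝ≥0∞) ^ (-β)) ^ i * ((2 : ℝ≥0∞) ^ (-β)) ^ (n + 1) := by
          refine ENNReal.tsum_le_tsum fun i => ?_
          rw [← pow_add]
          exact mul_le_of_le_one_right' (hm _)
      _ = (1 - (2 : ℝ≥0∞) ^ (-β))⁻¹ * ((2 : ℝ≥0∞) ^ (-β)) ^ (n + 1) := by
          rw [ENNReal.tsum_mul_right, ENNReal.tsum_geometric]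
      _ ≤ _ := by
          gcongr
          have h := ENNReal.one_le_rpow hn' h0
          rw [ENNReal.mul_rpow_of_nonneg _ _ h0.le] at h
          rw [← ENNReal.rpow_natCast, ← ENNReal.rpow_mul, mul_comm, ENNReal.rpow_mul,
            ENNReal.rpow_natCast, ENNReal.rpow_neg]
          rw [ENNReal.inv_le_iff_le_mul (by simp) (by simp)]
          exact h

variable {d : ℕ} {Ω : Set (E d)}

lemma le_edist_of_mem_scaleSet {R : ℝ} {i : ℕ} {z : Ω × Ω} (hz : z ∈ scaleSet Ω R i) :
    ENNReal.ofReal R * 2⁻¹ ^ (i + 1) ≤ edist z.1 z.2 := by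
  obtain ⟨hz, rfl⟩ := hz
  have h := (lt_dist_mul_two_pow_scale (R := R) hz).le
  rw [← div_le_iff₀ (by positivity)] at h
  rw [edist_dist]
  refine le_trans (le_of_eq ?_) (ENNReal.ofReal_le_ofReal h)
  rw [ENNReal.ofReal_div_of_pos (by positivity), div_eq_mul_inv, ← ENNReal.inv_pow,
    ENNReal.ofReal_pow zero_le_two, ENNReal.ofReal_ofNat]

/-- Chebyshev's inequality, kept local to one scale so that it can also be summed over the disjoint
scale sets. -/
lemma mul_measure_scaleSet_le (γ : Measure (Ω × Ω)) {q : ℝ} (hq : 0 ≤ q) (R : ℝ) (i : ℕ) :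
    (ENNReal.ofReal R * 2⁻¹ ^ (i + 1)) ^ q * γ (scaleSet Ω R i) ≤
      ∫⁻ z in scaleSet Ω R i, edist z.1 z.2 ^ q ∂γ := by
  rw [← setLIntegral_const]
  exact setLIntegral_mono' (measurableSet_scaleSet R i) fun z hz =>
    ENNReal.rpow_le_rpow (le_edist_of_mem_scaleSet hz) hq

/-- The cost of exponent `1/α` of a transport plan, to the power `α`, in units of `R/2`. -/
noncomputable def scaledCost (R α : ℝ) (γ : Measure (Ω × Ω)) : ℝ≥0∞ :=
  2 * (ENNReal.ofReal R)⁻¹ * (∫⁻ z, edist z.1 z.2 ^ (1 / α) ∂γ) ^ α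

lemma two_mul_inv_mul_cancel {R : ℝ} (hR : 0 < R) (i : ℕ) (a : ℝ≥0∞) :
    2 * (ENNReal.ofReal R)⁻¹ * (ENNReal.ofReal R * 2⁻¹ ^ (i + 1) * a) = 2⁻¹ ^ i * a := by
  have h1 : (ENNReal.ofReal R)⁻¹ * ENNReal.ofReal R = 1 :=
    ENNReal.inv_mul_cancel (by simpa using hR) ENNReal.ofReal_ne_top
  have h2 : (2 : ℝ≥0∞) * 2⁻¹ = 1 := ENNReal.mul_inv_cancel two_ne_zero ENNReal.ofNat_ne_top
  calc _ = ((ENNReal.ofReal R)⁻¹ * ENNReal.ofReal R) * (2 * 2⁻¹) * 2⁻¹ ^ i * a := by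
        rw [pow_succ]; ring
    _ = _ := by rw [h1, h2, one_mul, one_mul]

lemma measure_scaleSet_rpow_le (γ : Measure (Ω × Ω)) {α R : ℝ} (h0 : 0 < α) (hR : 0 < R)
    (i : ℕ) : γ (scaleSet Ω R i) ^ α ≤ 2 ^ i * scaledCost R α γ := by
  have h := ENNReal.rpow_le_rpow ((mul_measure_scaleSet_le γ (one_div_pos.2 h0).le R i).trans
    (setLIntegral_le_lintegral _ _)) h0.le
  rw [ENNReal.mul_rpow_of_nonneg _ _ h0.le, ← ENNReal.rpow_mul, one_div_mul_cancel h0.ne',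
    ENNReal.rpow_one] at h
  have h' := mul_le_mul_right h (2 ^ i * (2 * (ENNReal.ofReal R)⁻¹))
  rw [mul_assoc, two_mul_inv_mul_cancel hR, ← mul_assoc, ← mul_pow,
    ENNReal.mul_inv_cancel two_ne_zero ENNReal.ofNat_ne_top, one_pow, one_mul, mul_assoc] at h'
  exact h'

lemma tsum_measure_scaleSet_le (γ : Measure (Ω × Ω)) {R : ℝ} (hR : 0 < R) :
    ∑' i, 2⁻¹ ^ i * γ (scaleSet Ω R i) ≤ scaledCost R 1 γ := by
  simp only [← two_mul_inv_mul_cancel hR]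
  rw [ENNReal.tsum_mul_left, scaledCost, ENNReal.rpow_one, div_one]
  refine mul_le_mul' le_rfl ?_
  calc _ ≤ ∑' i, ∫⁻ z in scaleSet Ω R i, edist z.1 z.2 ^ (1 : ℝ) ∂γ :=
        ENNReal.tsum_le_tsum fun i => by
          simpa only [ENNReal.rpow_one] using mul_measure_scaleSet_le γ zero_le_one R i
    _ = ∫⁻ z in ⋃ i, scaleSet Ω R i, edist z.1 z.2 ^ (1 : ℝ) ∂γ :=
        (lintegral_iUnion (measurableSet_scaleSet R) (pairwise_disjoint_scaleSet R) _).symm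
    _ ≤ _ := setLIntegral_le_lintegral _ _

lemma exists_tsum_scaleSet_le (hd : 1 ≤ d) {α β : ℝ} (h0 : 0 < α) (h1 : α ≤ 1)
    (hβ : β = d * (α - 1) + 1) (hβ0 : 0 < β) :
    ∃ C : ℝ≥0∞, C ≠ ⊤ ∧ ∀ (Ω : Set (E d)) (R : ℝ), 0 < R → ∀ (γ : Measure (Ω × Ω))
      [IsProbabilityMeasure γ],
      ∑' i, ((2 : ℝ≥0∞) ^ (-β)) ^ i * γ (scaleSet Ω R i) ^ α ≤ C * scaledCost R α γ ^ β := by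
  rcases h1.eq_or_lt with rfl | h1
  -- For α = β = 1 the splitting argument would lose a logarithm, so the Chebyshev bounds are summed
  -- over the disjoint scale sets instead.
  · refine ⟨1, ENNReal.one_ne_top, fun Ω R hR γ _ => ?_⟩
    obtain rfl : β = 1 := by simpa using hβ
    simpa [ENNReal.rpow_neg_one] using tsum_measure_scaleSet_le γ hR
  · have hβ1 : β < 1 := by
      have : (1 : ℝ) ≤ d := by exact_mod_cast hd
      nlinarith
    refine ⟨_, ENNReal.add_ne_top.2 ⟨inv_one_sub_two_rpow_neg_ne_top (sub_pos.2 hβ1),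
      inv_one_sub_two_rpow_neg_ne_top hβ0⟩, fun Ω R hR γ _ => ?_⟩
    exact tsum_geometric_mul_le hβ0 hβ1 (fun i => ENNReal.rpow_le_one prob_le_one h0.le)
      (fun i => measure_scaleSet_rpow_le γ h0 hR i)

end BranchedTransport

/-! ### Assembly of the estimate -/

namespace BranchedTransport

open Filter Topology

variable {d : ℕ} {Ω : Set (E d)}

/-- The exponent β arises here: length 2^(-k) against 2^(kd(1-α)) from the number of classes, with k
= i + n. -/
lemma stepLength_mul_rpow {R α β : ℝ} (h1 : α ≤ 1) (hβ : β = d * (α - 1) + 1) (n i : ℕ) :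
    stepLength d R n i * ((15 ^ d * (2 ^ (i + n)) ^ d : ℕ) : ℝ≥0∞) ^ (1 - α) =
      ENNReal.ofReal ((4 * d + 1) * R) * ((15 : ℝ≥0∞) ^ d) ^ (1 - α) *
        (((2 : ℝ≥0∞) ^ (-β)) ^ n * ((2 : ℝ≥0∞) ^ (-β)) ^ i) := by
  have key (k : ℕ) : (2⁻¹ : ℝ≥0∞) ^ k * ((2 ^ k) ^ d) ^ (1 - α) = ((2 : ℝ≥0∞) ^ (-β)) ^ k := by
    rw [← ENNReal.rpow_neg_one, ← ENNReal.rpow_natCast, ← ENNReal.rpow_natCast,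
      ← ENNReal.rpow_natCast, ← ENNReal.rpow_natCast, ← ENNReal.rpow_mul, ← ENNReal.rpow_mul,
      ← ENNReal.rpow_mul, ← ENNReal.rpow_mul,
      ← ENNReal.rpow_add _ _ two_ne_zero ENNReal.ofNat_ne_top, hβ]
    congr 1
    ring
  push_cast
  rw [ENNReal.mul_rpow_of_nonneg _ _ (by linarith), stepLength, ← pow_add, add_comm n i, ← key]
  ring

lemma rpow_lintegral_edist_mono (γ : Measure (Ω × Ω)) [IsProbabilityMeasure γ] {q p : ℝ}
    (hq : 0 < q) (hqp : q ≤ p) :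
    (∫⁻ z, edist z.1 z.2 ^ q ∂γ) ^ (1 / q) ≤ (∫⁻ z, edist z.1 z.2 ^ p ∂γ) ^ (1 / p) := by
  have h := eLpNorm'_le_eLpNorm'_of_exponent_le hq hqp γ
    (f := fun z : Ω × Ω => dist z.1 z.2) (by fun_prop)
  have he (z : Ω × Ω) : ‖dist z.1 z.2‖ₑ = edist z.1 z.2 := by
    rw [Real.enorm_of_nonneg dist_nonneg, edist_dist]
  simpa only [eLpNorm', he] using h

lemma exists_branchedDist_le (hd : 1 ≤ d) {α β : ℝ} (h0 : 0 < α) (h1 : α ≤ 1)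
    (hβ : β = d * (α - 1) + 1) (hβ0 : 0 < β) {R : ℝ} (hR : 0 < R) :
    ∃ C : ℝ≥0, 0 < C ∧ ∀ Ω : Set (E d), Convex ℝ Ω → IsCompact Ω → (∀ x y : Ω, dist x y ≤ R) →
      ∀ (μ₀ μ₁ : Measure Ω) (γ : Measure (Ω × Ω)) [IsProbabilityMeasure γ],
        IsTransportPlan μ₀ μ₁ γ → ∀ p : ℝ, 1 / α ≤ p →
          branchedDist α μ₀ μ₁ ≤ C * ((∫⁻ z, edist z.1 z.2 ^ p ∂γ) ^ (1 / p)) ^ β := by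
  obtain ⟨C, hC, h⟩ := exists_tsum_scaleSet_le hd h0 h1 hβ hβ0
  set A : ℝ≥0∞ := 2 * (ENNReal.ofReal ((4 * d + 1) * R) * ((15 : ℝ≥0∞) ^ d) ^ (1 - α)) with hA
  set G : ℝ≥0∞ := (1 - (2 : ℝ≥0∞) ^ (-β))⁻¹ with hG
  set K : ℝ≥0∞ := A * (G * C) * (2 * (ENNReal.ofReal R)⁻¹) ^ β with hK
  have hKt : K ≠ ⊤ := by
    refine ENNReal.mul_ne_top (ENNReal.mul_ne_top ?_ (ENNReal.mul_ne_top
      (inv_one_sub_two_rpow_neg_ne_top hβ0) hC)) (ENNReal.rpow_ne_top_of_nonneg hβ0.le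
      (ENNReal.mul_ne_top ENNReal.ofNat_ne_top (ENNReal.inv_ne_top.2 (by simpa using hR))))
    refine ENNReal.mul_ne_top ENNReal.ofNat_ne_top (ENNReal.mul_ne_top ENNReal.ofReal_ne_top
      (ENNReal.rpow_ne_top_of_nonneg (by linarith) (ENNReal.pow_ne_top ENNReal.ofNat_ne_top)))
  -- Adding 1 makes the constant positive, so that it can be divided out when passing to the infimum
  -- over plans.
  refine ⟨K.toNNReal + 1, by positivity, fun Ω hΩ hc hD μ₀ μ₁ γ _ hγ p hp => ?_⟩
  have hα : 0 < 1 / α := one_div_pos.2 h0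
  calc branchedDist α μ₀ μ₁
      ≤ ∑' n, ∑' i, 2 * (stepLength d R n i *
        ((15 ^ d * (2 ^ (i + n)) ^ d : ℕ) : ℝ≥0∞) ^ (1 - α) * γ (scaleSet Ω R i) ^ α) :=
        branchedDist_le_tsum_scaleSet hc hΩ hR hD h0 h1 γ hγ
    _ = ∑' n, ∑' i, A * (((2 : ℝ≥0∞) ^ (-β)) ^ n *
        (((2 : ℝ≥0∞) ^ (-β)) ^ i * γ (scaleSet Ω R i) ^ α)) := by
        refine tsum_congr fun n => tsum_congr fun i => ?_
        rw [stepLength_mul_rpow h1 hβ, hA]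
        ring
    _ = A * (G * ∑' i, ((2 : ℝ≥0∞) ^ (-β)) ^ i * γ (scaleSet Ω R i) ^ α) := by
        simp only [ENNReal.tsum_mul_left, ENNReal.tsum_mul_right, ENNReal.tsum_geometric, hG]
    _ ≤ A * (G * (C * scaledCost R α γ ^ β)) := by
        gcongr
        exact h Ω R hR γ
    _ = K * ((∫⁻ z, edist z.1 z.2 ^ (1 / α) ∂γ) ^ (1 / (1 / α))) ^ β := by
        rw [scaledCost, ENNReal.mul_rpow_of_nonneg _ _ hβ0.le, hK, one_div_one_div]
        ring
    _ ≤ (K.toNNReal + 1 : ℝ≥0) * ((∫⁻ z, edist z.1 z.2 ^ p ∂γ) ^ (1 / p)) ^ β := by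
        gcongr
        · rw [ENNReal.coe_add, ENNReal.coe_toNNReal hKt]
          exact le_self_add
        · exact rpow_lintegral_edist_mono γ hα hp

/-- Solving the inequality for the cost T turns it into a lower bound on T, which passes to the
infimum. -/
lemma le_mul_wasserstein_rpow {μ₀ μ₁ : Measure Ω} {p β : ℝ} (hp : 0 < p) (hβ : 0 < β)
    {C : ℝ≥0} (hC : 0 < C) {a : ℝ≥0∞}
    (h : ∀ γ : Measure (Ω × Ω), IsTransportPlan μ₀ μ₁ γ →
      a ≤ C * ((∫⁻ z, edist z.1 z.2 ^ p ∂γ) ^ (1 / p)) ^ β) :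
    a ≤ C * wasserstein p μ₀ μ₁ ^ β := by
  have hC0 : (C : ℝ≥0∞) ≠ 0 := by exact_mod_cast hC.ne'
  have key (T : ℝ≥0∞) : a ≤ C * (T ^ (1 / p)) ^ β ↔ ((a / C) ^ β⁻¹) ^ p ≤ T := by
    rw [mul_comm, ← ENNReal.div_le_iff hC0 ENNReal.coe_ne_top, ← ENNReal.rpow_inv_le_iff hβ,
      one_div, ENNReal.le_rpow_inv_iff hp]
  rw [wasserstein, key]
  exact le_iInf₂ fun γ hγ => (key _).1 (h γ hγ)

end BranchedTransport

theorem mainTheorem6 (d : ℕ) (hd : 1 ≤ d) (α : ℝ) (hα : α ∈ Set.Ioc (1 - 1 / (d : ℝ)) 1)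
    (D : ℝ) :
    ∃ C : ℝ≥0, ∀ Ω : Set (EuclideanSpace ℝ (Fin d)), Convex ℝ Ω → IsCompact Ω →
      Metric.diam Ω = D →
      ∀ (μ₀ μ₁ : Measure Ω) [IsProbabilityMeasure μ₀] [IsProbabilityMeasure μ₁] (p : ℝ),
        1 / α ≤ p →
        BranchedTransport.branchedDist α μ₀ μ₁ ≤
          (C : ℝ≥0∞) * BranchedTransport.wasserstein p μ₀ μ₁ ^ ((d : ℝ) * (α - 1) + 1) := by
  have hd' : (1 : ℝ) ≤ d := by exact_mod_cast hd
  have hα0 : 0 < α := by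
    have : 1 / (d : ℝ) ≤ 1 := (div_le_one (by linarith)).2 hd'
    linarith [hα.1]
  have hβ0 : 0 < (d : ℝ) * (α - 1) + 1 := by
    have h : 0 < d * (α - (1 - 1 / (d : ℝ))) := mul_pos (by linarith) (sub_pos.2 hα.1)
    have h' : (d : ℝ) * (1 / d) = 1 := mul_one_div_cancel (by linarith)
    linarith
  obtain ⟨C, hC, h⟩ := BranchedTransport.exists_branchedDist_le hd hα0 hα.2 rfl hβ0
    -- The grid needs a positive side, while D may be 0 or negative.
    (R := max D 1) (lt_max_of_lt_right one_pos)
  refine ⟨C, fun Ω hΩ hc hD μ₀ μ₁ _ _ p hp => ?_⟩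
  refine BranchedTransport.le_mul_wasserstein_rpow ((one_div_pos.2 hα0).trans_le hp) hβ0 hC
    fun γ hγ => ?_
  -- A transport plan is only required to have the right marginals; its total mass is read off the
  -- first one.
  have hγ1 : IsProbabilityMeasure γ := by
    refine ⟨?_⟩
    have : (γ.map Prod.fst) Set.univ = 1 := by rw [hγ.map_fst]; exact measure_univ
    rwa [Measure.map_apply measurable_fst MeasurableSet.univ] at this
  exact h Ω hΩ hc (fun x y => (Metric.dist_le_diam_of_mem hc.isBounded x.2 y.2).trans
    (hD.le.trans (le_max_left _ _))) μ₀ μ₁ γ hγ p hp
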